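/- Let $p$ be a prime, let $\mathbb{Q}_p$ be the field of $p$-adic numbers with Haar measure $m$ normalized by $m(\mathbb{Z}_p)=1$, and let $\alpha>0$, $\sigma>0$ be real numbers. Let $\mathfrak{D}^\alpha$ be the Taibleson–Vladimirov operator of fractional derivative of order $\alpha$, i.e. the self-adjoint operator in $L^2(\mathbb{Q}_p,m)$ with $\widehat{\mathfrak{D}^\alpha f}(\xi)=|\xi|_p^{\alpha}\,\widehat f(\xi)$ on its maximal domain, where $\widehat{\ \cdot\ }$ is the Fourier transform on $L^2(\mathbb{Q}_p,m)$ with respect to the standard additive character of $\mathbb{Q}_p$. Let $V=\sigma 1_{\mathbb{Z}_p}$ and $H=\mathfrak{D}^\alpha-V$, and let $\mathrm{Neg}(H)$ denote the number of negative eigenvalues of $H$ counted with their multiplicity. Then: 1. if $\sigma\le\dfrac{p-p^\alpha}{p-1}$, then $\mathrm{Neg}(H)=0$; 2. if $\dfrac{p-p^\alpha}{p-1}<\sigma\le p^\alpha$, then $\mathrm{Neg}(H)=1$; 3. if $\sigma>p^\alpha$, then $\mathrm{Neg}(H)$ is finite and $$\frac{1}{2p}\int_{\mathbb{Q}_p}V(x)^{1/\alpha}\,dm(x)\;\le\;\mathrm{Neg}(H)\;\le\;\frac32\int_{\mathbb{Q}_p}V(x)^{1/\alpha}\,dm(x).$$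 -/

import Mathlib

open MeasureTheory
open scoped ENNReal FourierTransform

namespace PadicSchrodinger

/-! ### Haar measure on `ℚ_p` -/

/-- The Borel `σ`-algebra on `ℚ_p`. -/
noncomputable instance instMeasurableSpacePadic (p : ℕ) [Fact p.Prime] : MeasurableSpace ℚ_[p] := borel _

instance instBorelSpacePadic (p : ℕ) [Fact p.Prime] : BorelSpace ℚ_[p] := ⟨rfl⟩

/-- `ℤ_p` as a subset of `ℚ_p`. -/
def integerBall (p : ℕ) [Fact p.Prime] : Set ℚ_[p] := {x | ‖x‖ ≤ 1}

theorem integerBall_eq (p : ℕ) [Fact p.Prime] :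
    integerBall p = Metric.closedBall (0 : ℚ_[p]) 1 := by
  ext x; simp [integerBall]

theorem measurableSet_integerBall (p : ℕ) [Fact p.Prime] : MeasurableSet (integerBall p) := by
  rw [integerBall_eq]; exact measurableSet_closedBall

/-- `ℤ_p` as a compact subset of `ℚ_p` with non-empty interior. -/
def integerCompacts (p : ℕ) [Fact p.Prime] : TopologicalSpace.PositiveCompacts ℚ_[p] where
  carrier := integerBall p
  isCompact' := by rw [integerBall_eq]; exact isCompact_closedBall _ _
  interior_nonempty' := by
    rw [integerBall_eq]
    exact ⟨0, Metric.ball_subset_interior_closedBall (Metric.mem_ball_self one_pos)⟩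

/-- The Haar measure `m` on `ℚ_p` with `m(ℤ_p) = 1`. -/
noncomputable def haar (p : ℕ) [Fact p.Prime] : Measure ℚ_[p] :=
  Measure.addHaarMeasure (integerCompacts p)

instance instIsAddHaarMeasureHaar (p : ℕ) [Fact p.Prime] : (haar p).IsAddHaarMeasure :=
  Measure.isAddHaarMeasure_addHaarMeasure _

theorem haar_integerBall (p : ℕ) [Fact p.Prime] : haar p (integerBall p) = 1 :=
  Measure.addHaarMeasure_self (K₀ := integerCompacts p)

/-- The complex Hilbert space `L²(ℚ_p, m)`. -/
abbrev L2 (p : ℕ) [Fact p.Prime] : Type := Lp ℂ 2 (haar p)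

/-! ### The standard additive character of `ℚ_p` -/

theorem norm_pow_mul_le_one (p : ℕ) [Fact p.Prime] (x : ℚ_[p]) :
    ‖(p : ℚ_[p]) ^ (-x.valuation).toNat * x‖ ≤ 1 := by
  rcases eq_or_ne x 0 with rfl | hx
  · simp
  have hp : (1 : ℝ) < p := by exact_mod_cast (Fact.out : p.Prime).one_lt
  rw [norm_mul, Padic.norm_p_pow, Padic.norm_eq_zpow_neg_valuation hx,
    ← zpow_add₀ (by positivity)]
  exact zpow_le_one_of_nonpos₀ hp.le (by have := Int.self_le_toNat (-x.valuation); lia)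

/-- The fractional part `{x}_p ∈ ℤ[1/p] ∩ [0, 1)` of `x ∈ ℚ_p`: if `p ^ n * x ∈ ℤ_p`, it is
`a / p ^ n` with `0 ≤ a < p ^ n` the residue of `p ^ n * x` modulo `p ^ n`. -/
noncomputable def fracPart (p : ℕ) [Fact p.Prime] (x : ℚ_[p]) : ℚ :=
  (PadicInt.appr (⟨(p : ℚ_[p]) ^ (-x.valuation).toNat * x, norm_pow_mul_le_one p x⟩ : ℤ_[p])
    (-x.valuation).toNat : ℚ) / (p : ℚ) ^ (-x.valuation).toNat

theorem norm_sub_fracPart_le (p : ℕ) [Fact p.Prime] (x : ℚ_[p]) :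
    ‖x - (fracPart p x : ℚ_[p])‖ ≤ 1 := by
  set n := (-x.valuation).toNat with hn
  set y : ℤ_[p] := ⟨(p : ℚ_[p]) ^ n * x, norm_pow_mul_le_one p x⟩ with hy
  have hp0 : (p : ℚ_[p]) ≠ 0 := by exact_mod_cast (Fact.out : p.Prime).ne_zero
  have h1 : ‖y - (y.appr n : ℤ_[p])‖ ≤ (p : ℝ) ^ (-(n : ℤ)) :=
    (PadicInt.norm_le_pow_iff_mem_span_pow _ n).2 (PadicInt.appr_spec n y)
  have h2 : (p : ℚ_[p]) ^ n * (x - (fracPart p x : ℚ_[p])) =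
      ((y - (y.appr n : ℤ_[p]) : ℤ_[p]) : ℚ_[p]) := by
    have : (fracPart p x : ℚ_[p]) = (y.appr n : ℚ_[p]) / (p : ℚ_[p]) ^ n := by
      simp [fracPart, hy, hn]
    rw [this]
    push_cast
    field_simp
    simp [hy]
  have h3 := congrArg norm h2
  rw [norm_mul, Padic.norm_p_pow, ← PadicInt.norm_def] at h3
  have hpos : (0 : ℝ) < (p : ℝ) ^ (-(n : ℤ)) := by
    have : (0 : ℝ) < p := by exact_mod_cast (Fact.out : p.Prime).pos
    positivity
  rw [← h3] at h1
  exact (mul_le_iff_le_one_right hpos).1 h1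

theorem fracPart_mem (p : ℕ) [Fact p.Prime] (x : ℚ_[p]) :
    ∃ (a : ℤ) (n : ℕ), fracPart p x = a / (p : ℚ) ^ n :=
  ⟨(PadicInt.appr (⟨(p : ℚ_[p]) ^ (-x.valuation).toNat * x, norm_pow_mul_le_one p x⟩ : ℤ_[p])
    (-x.valuation).toNat : ℕ), (-x.valuation).toNat, by simp [fracPart]⟩

theorem fracPart_nonneg (p : ℕ) [Fact p.Prime] (x : ℚ_[p]) : 0 ≤ fracPart p x := by
  unfold fracPart; positivity

theorem fracPart_lt_one (p : ℕ) [Fact p.Prime] (x : ℚ_[p]) : fracPart p x < 1 := by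
  have hp : 0 < p := (Fact.out : p.Prime).pos
  unfold fracPart
  rw [div_lt_one (by positivity)]
  exact_mod_cast PadicInt.appr_lt _ _

theorem exists_int_of_norm_le_one (p : ℕ) [Fact p.Prime] (a : ℤ) (n : ℕ)
    (h : ‖(((a : ℚ) / (p : ℚ) ^ n : ℚ) : ℚ_[p])‖ ≤ 1) : ∃ k : ℤ, (a : ℚ) / (p : ℚ) ^ n = k := by
  have hp : 0 < p := (Fact.out : p.Prime).pos
  have hp' : (0 : ℝ) < p := by exact_mod_cast hp
  push_cast at h
  rw [norm_div, Padic.norm_p_pow, div_le_one (by positivity)] at h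
  obtain ⟨k, hk⟩ := (Padic.norm_int_le_pow_iff_dvd a n).1 h
  refine ⟨k, ?_⟩
  rw [hk]
  push_cast
  field_simp

theorem fourierChar_int (k : ℤ) : 𝐞 (k : ℝ) = 1 := by
  ext
  rw [Real.fourierChar_apply, Circle.coe_one, Complex.exp_eq_one_iff]
  exact ⟨k, by push_cast; ring⟩

theorem fourierChar_fracPart (p : ℕ) [Fact p.Prime] (x : ℚ_[p]) (a : ℤ) (n : ℕ)
    (h : ‖x - (((a : ℚ) / (p : ℚ) ^ n : ℚ) : ℚ_[p])‖ ≤ 1) :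
    𝐞 (fracPart p x : ℝ) = 𝐞 (((a : ℚ) / (p : ℚ) ^ n : ℚ) : ℝ) := by
  have hp : (p : ℚ) ≠ 0 := by exact_mod_cast (Fact.out : p.Prime).ne_zero
  obtain ⟨b, m, hb⟩ := fracPart_mem p x
  have e : fracPart p x - (a : ℚ) / (p : ℚ) ^ n =
      ((b * (p : ℤ) ^ n - a * (p : ℤ) ^ m : ℤ) : ℚ) / (p : ℚ) ^ (m + n) := by
    rw [hb, pow_add]; push_cast; field_simp
  have hle : ‖((fracPart p x - (a : ℚ) / (p : ℚ) ^ n : ℚ) : ℚ_[p])‖ ≤ 1 := by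
    have h1 := norm_sub_fracPart_le p x
    rw [norm_sub_rev] at h1
    have := (Padic.nonarchimedean ((fracPart p x : ℚ_[p]) - x)
      (x - (((a : ℚ) / (p : ℚ) ^ n : ℚ) : ℚ_[p]))).trans (max_le h1 h)
    simpa using this
  rw [e] at hle
  obtain ⟨k, hk⟩ := exists_int_of_norm_le_one p _ _ hle
  rw [← e, sub_eq_iff_eq_add] at hk
  rw [hk]
  push_cast
  rw [AddChar.map_add_eq_mul, fourierChar_int, one_mul]

/-- The standard additive character `χ_p(x) = exp(2πi{x}_p)` of `ℚ_p`. -/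
noncomputable def stdChar (p : ℕ) [Fact p.Prime] : AddChar ℚ_[p] Circle where
  toFun x := 𝐞 (fracPart p x : ℝ)
  map_zero_eq_one' := by
    rw [fourierChar_fracPart p 0 0 0 (by simp)]; simp
  map_add_eq_mul' x y := by
    have hp : (p : ℚ) ≠ 0 := by exact_mod_cast (Fact.out : p.Prime).ne_zero
    obtain ⟨a, m, ha⟩ := fracPart_mem p x
    obtain ⟨b, n, hb⟩ := fracPart_mem p y
    have e : fracPart p x + fracPart p y =
        ((a * (p : ℤ) ^ n + b * (p : ℤ) ^ m : ℤ) : ℚ) / (p : ℚ) ^ (m + n) := by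
      rw [ha, hb, pow_add]; push_cast; field_simp
    rw [fourierChar_fracPart p (x + y) (a * (p : ℤ) ^ n + b * (p : ℤ) ^ m) (m + n), ← e]
    · push_cast; rw [AddChar.map_add_eq_mul]
    · rw [← e]
      have := (Padic.nonarchimedean (x - (fracPart p x : ℚ_[p])) (y - (fracPart p y : ℚ_[p]))).trans
        (max_le (norm_sub_fracPart_le p x) (norm_sub_fracPart_le p y))
      rw [Rat.cast_add, add_sub_add_comm]
      exact this

theorem stdChar_apply (p : ℕ) [Fact p.Prime] (x : ℚ_[p]) :
    stdChar p x = 𝐞 (fracPart p x : ℝ) := rfl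

theorem stdChar_eq_one (p : ℕ) [Fact p.Prime] {x : ℚ_[p]} (hx : ‖x‖ ≤ 1) : stdChar p x = 1 := by
  rw [stdChar_apply, fourierChar_fracPart p x 0 0 (by simpa using hx)]; simp

theorem stdChar_inv_ne_one (p : ℕ) [Fact p.Prime] : stdChar p (p : ℚ_[p])⁻¹ ≠ 1 := by
  have hp : (1 : ℝ) < p := by exact_mod_cast (Fact.out : p.Prime).one_lt
  rw [stdChar_apply, fourierChar_fracPart p _ 1 1 (by simp)]
  intro h
  have h' := congrArg (fun z : Circle => (z : ℂ)) h
  simp only [Circle.coe_one, Real.fourierChar_apply] at h'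
  obtain ⟨k, hk⟩ := Complex.exp_eq_one_iff.1 h'
  have hk2 : (2 * Real.pi * Complex.I) * ((p : ℂ)⁻¹ - k) = 0 := by
    push_cast at hk
    linear_combination hk
  rcases mul_eq_zero.1 hk2 with h0 | h0
  · exact Complex.two_pi_I_ne_zero h0
  · have h1 : (p : ℝ)⁻¹ = k := Complex.ofReal_injective (by push_cast; exact sub_eq_zero.1 h0)
    have h2 : (0 : ℝ) < k := h1 ▸ by positivity
    have h3 : (k : ℝ) < 1 := h1 ▸ inv_lt_one_of_one_lt₀ hp
    have h4 : 0 < k := by exact_mod_cast h2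
    have h5 : k < 1 := by exact_mod_cast h3
    lia

theorem continuous_stdChar (p : ℕ) [Fact p.Prime] : Continuous (stdChar p) := by
  refine (IsLocallyConstant.iff_exists_open _).2 (fun x => ?_) |>.continuous
  refine ⟨Metric.ball x 1, Metric.isOpen_ball, Metric.mem_ball_self one_pos, fun y hy => ?_⟩
  have : y = x + (y - x) := by ring
  rw [this, AddChar.map_add_eq_mul, stdChar_eq_one p (x := y - x), mul_one]
  rw [← dist_eq_norm]; exact (Metric.mem_ball.1 hy).le

/-! ### Fourier transform -/

/-- The space `𝒟` of test functions: locally constant with compact support. -/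
def IsTest {p : ℕ} [Fact p.Prime] (φ : ℚ_[p] → ℂ) : Prop :=
  IsLocallyConstant φ ∧ HasCompactSupport φ

theorem IsTest.memLp {p : ℕ} [Fact p.Prime] {φ : ℚ_[p] → ℂ} (h : IsTest φ) (q : ℝ≥0∞) :
    MemLp φ q (haar p) :=
  h.1.continuous.memLp_of_hasCompactSupport h.2

/-- The Fourier transform of a test function is continuous with compact support, for the character
`stdChar p` as well as for its inverse. -/
theorem IsTest.fourier {p : ℕ} [Fact p.Prime] {φ : ℚ_[p] → ℂ} (h : IsTest φ)
    {e : AddChar ℚ_[p] Circle} (he : Continuous e) (he1 : e (p : ℚ_[p])⁻¹ ≠ 1) :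
    Continuous (Fourier.fourierIntegral e (haar p) φ) ∧
      HasCompactSupport (Fourier.fourierIntegral e (haar p) φ) := by
  refine ⟨VectorFourier.fourierIntegral_continuous he (by exact continuous_mul)
    (memLp_one_iff_integrable.1 (h.memLp 1)), ?_⟩
  obtain ⟨δ, hδ, hc⟩ := lebesgue_number_lemma_of_metric (s := tsupport φ) (c := fun z => φ ⁻¹' {z})
    h.2 (fun z => h.1.isOpen_fiber z) (fun x _ => Set.mem_iUnion.2 ⟨φ x, rfl⟩)
  have key : ∀ x k : ℚ_[p], ‖k‖ < δ → φ (x + k) = φ x := by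
    intro x k hk
    by_cases hx : x ∈ tsupport φ
    · obtain ⟨z, hz⟩ := hc x hx
      have h1 : φ (x + k) = z := hz (by simpa using hk)
      have h2 : φ x = z := hz (Metric.mem_ball_self hδ)
      rw [h1, h2]
    by_cases hx' : x + k ∈ tsupport φ
    · obtain ⟨z, hz⟩ := hc _ hx'
      have h1 : φ x = z := hz (by simpa [dist_eq_norm] using hk)
      have h2 : φ (x + k) = z := hz (Metric.mem_ball_self hδ)
      rw [h1, h2]
    rw [image_eq_zero_of_notMem_tsupport hx, image_eq_zero_of_notMem_tsupport hx']
  refine HasCompactSupport.intro (isCompact_closedBall (0 : ℚ_[p]) (p / δ)) fun ξ hξ => ?_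
  have hp : (p : ℚ_[p]) ≠ 0 := by exact_mod_cast (Fact.out : p.Prime).ne_zero
  have hp' : (0 : ℝ) < p := by exact_mod_cast (Fact.out : p.Prime).pos
  have hξ' : (p : ℝ) / δ < ‖ξ‖ := by simpa using hξ
  have hξ0 : ξ ≠ 0 := norm_pos_iff.1 (lt_trans (by positivity) hξ')
  have hk : ‖-((p : ℚ_[p])⁻¹ * ξ⁻¹)‖ < δ := by
    rw [norm_neg, norm_mul, norm_inv, norm_inv, Padic.norm_p, inv_inv, ← div_eq_mul_inv,
      div_lt_comm₀ (norm_pos_iff.2 hξ0) hδ]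
    exact hξ'
  have hint : Fourier.fourierIntegral e (haar p) φ ξ =
      (e (p : ℚ_[p])⁻¹ : ℂ) * Fourier.fourierIntegral e (haar p) φ ξ := by
    conv_lhs => rw [Fourier.fourierIntegral_def,
      ← integral_add_right_eq_self _ (-((p : ℚ_[p])⁻¹ * ξ⁻¹))]
    rw [Fourier.fourierIntegral_def, ← integral_const_mul]
    refine integral_congr_ae (Filter.Eventually.of_forall fun v => ?_)
    simp only [key v _ hk, Circle.smul_def, smul_eq_mul]
    have : -((v + -((p : ℚ_[p])⁻¹ * ξ⁻¹)) * ξ) = (p : ℚ_[p])⁻¹ + -(v * ξ) := by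
      field_simp; ring
    rw [this, AddChar.map_add_eq_mul, Circle.coe_mul, mul_assoc]
  by_contra hne
  refine he1 (Circle.ext ?_)
  have : ((e (p : ℚ_[p])⁻¹ : ℂ) - 1) * Fourier.fourierIntegral e (haar p) φ ξ = 0 := by
    linear_combination -hint
  rcases mul_eq_zero.1 this with h0 | h0
  · simpa using sub_eq_zero.1 h0
  · exact absurd h0 hne

theorem IsTest.memLp_fourier {p : ℕ} [Fact p.Prime] {φ : ℚ_[p] → ℂ} (h : IsTest φ) :
    MemLp (Fourier.fourierIntegral (stdChar p) (haar p) φ) 2 (haar p) :=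
  have := h.fourier (continuous_stdChar p) (stdChar_inv_ne_one p)
  this.1.memLp_of_hasCompactSupport this.2

theorem IsTest.memLp_fourierInv {p : ℕ} [Fact p.Prime] {φ : ℚ_[p] → ℂ} (h : IsTest φ) :
    MemLp (Fourier.fourierIntegral (stdChar p)⁻¹ (haar p) φ) 2 (haar p) :=
  have := h.fourier (e := (stdChar p)⁻¹)
    (by
      have : Continuous fun x => stdChar p (-x) := (continuous_stdChar p).comp continuous_neg
      exact this)
    (by rw [AddChar.inv_apply', inv_ne_one]; exact stdChar_inv_ne_one p)
  this.1.memLp_of_hasCompactSupport this.2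

/-- `g = 𝓕 f` in `L²(ℚ_p)`, the Fourier transform being extended from `𝒟` to `L²` by duality:
`∫ g φ dm = ∫ f φ̂ dm` for every test function `φ`, where `φ̂(ξ) = ∫ χ_p(-xξ) φ(x) dm(x)`. -/
def IsFourier {p : ℕ} [Fact p.Prime] (f g : L2 p) : Prop :=
  ∀ φ : ℚ_[p] → ℂ, IsTest φ →
    ∫ x, g x * φ x ∂haar p =
      ∫ x, f x * Fourier.fourierIntegral (stdChar p) (haar p) φ x ∂haar p

/-- `g = 𝓕⁻¹ f` in `L²(ℚ_p)`: the same with the inverse character `χ_p⁻¹`. -/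
def IsFourierInv {p : ℕ} [Fact p.Prime] (f g : L2 p) : Prop :=
  ∀ φ : ℚ_[p] → ℂ, IsTest φ →
    ∫ x, g x * φ x ∂haar p =
      ∫ x, f x * Fourier.fourierIntegral (stdChar p)⁻¹ (haar p) φ x ∂haar p

theorem integrable_mul {p : ℕ} [Fact p.Prime] (f : L2 p) {ψ : ℚ_[p] → ℂ}
    (h : MemLp ψ 2 (haar p)) : Integrable (fun x => f x * ψ x) (haar p) :=
  (Lp.memLp f).integrable_mul h

theorem integral_add_mul {p : ℕ} [Fact p.Prime] (f g : L2 p) {ψ : ℚ_[p] → ℂ}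
    (h : MemLp ψ 2 (haar p)) :
    ∫ x, (f + g : L2 p) x * ψ x ∂haar p =
      ∫ x, f x * ψ x ∂haar p + ∫ x, g x * ψ x ∂haar p := by
  rw [← integral_add (integrable_mul f h) (integrable_mul g h)]
  refine integral_congr_ae ?_
  filter_upwards [Lp.coeFn_add f g] with x hx
  simp only [hx, Pi.add_apply, add_mul]

theorem integral_smul_mul {p : ℕ} [Fact p.Prime] (c : ℂ) (f : L2 p) (ψ : ℚ_[p] → ℂ) :
    ∫ x, (c • f : L2 p) x * ψ x ∂haar p = c * ∫ x, f x * ψ x ∂haar p := by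
  rw [← integral_const_mul]
  refine integral_congr_ae ?_
  filter_upwards [Lp.coeFn_smul c f] with x hx
  simp only [hx, Pi.smul_apply, smul_eq_mul, mul_assoc]

theorem integral_zero_mul {p : ℕ} [Fact p.Prime] (ψ : ℚ_[p] → ℂ) :
    ∫ x, (0 : L2 p) x * ψ x ∂haar p = 0 := by
  have := integral_smul_mul (0 : ℂ) (0 : L2 p) ψ
  rwa [zero_smul, zero_mul] at this

/-- An `L²` function is determined by its integrals against test functions. -/
theorem eq_zero_of_forall_test {p : ℕ} [Fact p.Prime] (f : L2 p)
    (h : ∀ φ : ℚ_[p] → ℂ, IsTest φ → ∫ x, f x * φ x ∂haar p = 0) : f = 0 := by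
  have hloc : LocallyIntegrable f (haar p) :=
    (Lp.memLp f).locallyIntegrable (by norm_num)
  refine Lp.ext (Filter.EventuallyEq.trans ?_ (Lp.coeFn_zero ℂ 2 (haar p)).symm)
  refine ae_eq_zero_of_forall_setIntegral_isCompact_eq_zero' hloc fun K hK => ?_
  let U : ℕ → Set ℚ_[p] := fun n => Metric.thickening (1 / ((n : ℝ) + 1)) K
  have hU : ∀ n, IsClopen (U n) := fun n => by
    have hn : (0 : ℝ) < 1 / ((n : ℝ) + 1) := by positivity
    refine IsClopen.of_thickening_subset_self hn fun x hx => ?_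
    obtain ⟨y, hy, hxy⟩ := Metric.mem_thickening_iff.1 hx
    obtain ⟨z, hz, hyz⟩ := Metric.mem_thickening_iff.1 hy
    exact Metric.mem_thickening_iff.2
      ⟨z, hz, (IsUltrametricDist.dist_triangle_max x y z).trans_lt (max_lt hxy hyz)⟩
  have hUc : ∀ n, IsCompact (U n) := fun n =>
    Metric.isCompact_of_isClosed_isBounded (hU n).isClosed hK.isBounded.thickening
  have hanti : Antitone U := fun m n hmn =>
    Metric.thickening_mono (one_div_le_one_div_of_le (by positivity) (by gcongr)) K
  have hlim := tendsto_setIntegral_of_antitone (μ := haar p) (f := f)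
    (fun n => (hU n).isOpen.measurableSet) hanti ⟨0, hloc.integrableOn_isCompact (hUc 0)⟩
  have hInter : ⋂ n, U n = K := by
    refine Set.Subset.antisymm (fun x hx => ?_) (Set.subset_iInter fun n =>
      Metric.self_subset_thickening (by positivity) K)
    rw [← hK.isClosed.closure_eq, Metric.mem_closure_iff]
    intro ε hε
    obtain ⟨n, hn⟩ := exists_nat_one_div_lt hε
    obtain ⟨z, hz, hxz⟩ := Metric.mem_thickening_iff.1 (Set.mem_iInter.1 hx n)
    exact ⟨z, hz, hxz.trans hn⟩
  have hzero : ∀ n, ∫ x in U n, f x ∂haar p = 0 := fun n => by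
    have hT : IsTest ((U n).indicator fun _ => (1 : ℂ)) := by
      refine ⟨(IsLocallyConstant.iff_exists_open _).2 fun x => ?_,
        HasCompactSupport.intro (hUc n) fun x hx => Set.indicator_of_notMem hx _⟩
      by_cases hx : x ∈ U n
      · exact ⟨U n, (hU n).isOpen, hx, fun y hy => by simp [hx, hy]⟩
      · exact ⟨(U n)ᶜ, (hU n).compl.isOpen, hx, fun y hy => by
          rw [Set.indicator_of_notMem hx, Set.indicator_of_notMem hy]⟩
    rw [← integral_indicator (hU n).isOpen.measurableSet, ← h _ hT]
    refine integral_congr_ae (Filter.Eventually.of_forall fun x => ?_)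
    by_cases hx : x ∈ U n <;> simp [hx]
  rw [hInter] at hlim
  simp only [hzero] at hlim
  exact tendsto_nhds_unique hlim tendsto_const_nhds

/-! ### The operators -/

/-- The graph of `𝔇^α`: pairs `(f, h)` in `L² × L²` such that, with `F = 𝓕 f`, the function
`|ξ|_p^α F(ξ)` is in `L²` and `h` is its inverse Fourier transform. -/
def vladimirovGraph (p : ℕ) [Fact p.Prime] (α : ℝ) : Submodule ℂ (L2 p × L2 p) where
  carrier := {z | ∃ F G : L2 p, IsFourier z.1 F ∧
    (∀ᵐ ξ ∂haar p, G ξ = ((‖ξ‖ ^ α : ℝ) : ℂ) * F ξ) ∧ IsFourierInv G z.2}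
  zero_mem' := by
    refine ⟨0, 0, ?_, ?_, ?_⟩
    · intro φ hφ; simp only [Prod.fst_zero, integral_zero_mul]
    · filter_upwards [Lp.coeFn_zero ℂ 2 (haar p)] with ξ h0
      rw [h0]; simp
    · intro φ hφ; simp only [Prod.snd_zero, integral_zero_mul]
  add_mem' := by
    rintro ⟨f, h⟩ ⟨f', h'⟩ ⟨F, G, hF, hG, hh⟩ ⟨F', G', hF', hG', hh'⟩
    refine ⟨F + F', G + G', fun φ hφ => ?_, ?_, fun φ hφ => ?_⟩
    · simp only [Prod.mk_add_mk]
      rw [integral_add_mul _ _ (hφ.memLp 2), integral_add_mul _ _ hφ.memLp_fourier,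
        hF φ hφ, hF' φ hφ]
    · filter_upwards [hG, hG', Lp.coeFn_add F F', Lp.coeFn_add G G'] with ξ h1 h2 h3 h4
      simp only [h3, h4, Pi.add_apply, h1, h2, mul_add]
    · simp only [Prod.mk_add_mk]
      rw [integral_add_mul _ _ (hφ.memLp 2), integral_add_mul _ _ hφ.memLp_fourierInv,
        hh φ hφ, hh' φ hφ]
  smul_mem' := by
    rintro c ⟨f, h⟩ ⟨F, G, hF, hG, hh⟩
    refine ⟨c • F, c • G, fun φ hφ => ?_, ?_, fun φ hφ => ?_⟩
    · simp only [Prod.smul_mk]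
      rw [integral_smul_mul, integral_smul_mul, hF φ hφ]
    · filter_upwards [hG, Lp.coeFn_smul c F, Lp.coeFn_smul c G] with ξ h1 h3 h4
      simp only [h3, h4, Pi.smul_apply, h1, smul_eq_mul]; ring
    · simp only [Prod.smul_mk]
      rw [integral_smul_mul, integral_smul_mul, hh φ hφ]

/-- `𝔇^α` is single-valued. -/
theorem vladimirovGraph_functional (p : ℕ) [Fact p.Prime] (α : ℝ) :
    ∀ z ∈ vladimirovGraph p α, z.1 = 0 → z.2 = 0 := by
  rintro ⟨f, h⟩ ⟨F, G, hF, hG, hh⟩ (rfl : f = 0)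
  have hF0 : F = 0 := eq_zero_of_forall_test F fun φ hφ => by
    rw [hF φ hφ]; exact integral_zero_mul _
  have hG0 : G = 0 := by
    refine Lp.ext ?_
    filter_upwards [hG, Lp.coeFn_zero ℂ 2 (haar p)] with ξ h1 h2
    rw [h1, hF0, h2]; simp
  exact eq_zero_of_forall_test h fun φ hφ => by
    rw [hh φ hφ, hG0]; exact integral_zero_mul _

/-- The Taibleson-Vladimirov operator `𝔇^α`, the operator of fractional derivative of order `α`:
the (unbounded) `L²`-multiplier `𝔇^α f = 𝓕⁻¹(|ξ|_p^α 𝓕 f)` on its maximal domain. -/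
noncomputable def vladimirov (p : ℕ) [Fact p.Prime] (α : ℝ) : L2 p →ₗ.[ℂ] L2 p :=
  (vladimirovGraph p α).toLinearPMap

theorem vladimirov_graph (p : ℕ) [Fact p.Prime] (α : ℝ) :
    (vladimirov p α).graph = vladimirovGraph p α :=
  Submodule.toLinearPMap_graph_eq _ (vladimirovGraph_functional p α)

/-- The potential `V = σ 1_{ℤ_p}`. -/
noncomputable def potential (p : ℕ) [Fact p.Prime] (σ : ℝ) : ℚ_[p] → ℝ :=
  (integerBall p).indicator fun _ => σ

theorem memLp_potential_mul {p : ℕ} [Fact p.Prime] (σ : ℝ) (f : L2 p) :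
    MemLp (fun x => (potential p σ x : ℂ) * f x) 2 (haar p) := by
  have h := ((Lp.memLp f).const_mul (σ : ℂ)).indicator (measurableSet_integerBall p)
  convert h using 1
  ext x
  by_cases hx : x ∈ integerBall p <;> simp [potential, hx]

/-- The bounded operator of multiplication by `V = σ 1_{ℤ_p}` on `L²`. -/
noncomputable def potentialOp (p : ℕ) [Fact p.Prime] (σ : ℝ) : L2 p →ₗ[ℂ] L2 p where
  toFun f := (memLp_potential_mul σ f).toLp _
  map_add' f g := by
    refine Lp.ext ?_
    filter_upwards [(memLp_potential_mul σ (f + g)).coeFn_toLp,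
      (memLp_potential_mul σ f).coeFn_toLp, (memLp_potential_mul σ g).coeFn_toLp,
      Lp.coeFn_add f g, Lp.coeFn_add ((memLp_potential_mul σ f).toLp _)
        ((memLp_potential_mul σ g).toLp _)] with x h1 h2 h3 h4 h5
    rw [h1, h5, h4, Pi.add_apply, Pi.add_apply, h2, h3, mul_add]
  map_smul' c f := by
    refine Lp.ext ?_
    filter_upwards [(memLp_potential_mul σ (c • f)).coeFn_toLp,
      (memLp_potential_mul σ f).coeFn_toLp, Lp.coeFn_smul c f,
      Lp.coeFn_smul c ((memLp_potential_mul σ f).toLp _)] with x h1 h2 h3 h4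
    rw [h1, RingHom.id_apply, h4, h3, Pi.smul_apply, Pi.smul_apply, h2, smul_eq_mul, smul_eq_mul]
    ring

/-- The Schrödinger operator `H = 𝔇^α - V`, `V = σ 1_{ℤ_p}`, with the domain of `𝔇^α`. -/
noncomputable def schrodinger (p : ℕ) [Fact p.Prime] (α σ : ℝ) : L2 p →ₗ.[ℂ] L2 p :=
  (-potentialOp p σ) +ᵥ vladimirov p α

/-- The eigenspace `{f ∈ dom A : A f = t f}` of an unbounded operator `A`. -/
def eigenspace {E : Type} [AddCommGroup E] [Module ℂ E] (A : E →ₗ.[ℂ] E) (t : ℂ) :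
    Submodule ℂ E :=
  A.graph.comap (LinearMap.prod LinearMap.id (t • LinearMap.id))

theorem mem_eigenspace {E : Type} [AddCommGroup E] [Module ℂ E] (A : E →ₗ.[ℂ] E) (t : ℂ) (f : E) :
    f ∈ eigenspace A t ↔ ∃ hf : f ∈ A.domain, A ⟨f, hf⟩ = t • f := by
  simp [eigenspace, LinearPMap.mem_graph_iff]

/-- `Neg(A)`: the number of negative eigenvalues of `A` counted with their multiplicities, as a
cardinal number: the sum over all `t < 0` of the dimension of the eigenspace of `t`. -/
noncomputable def negCount {E : Type} [AddCommGroup E] [Module ℂ E] (A : E →ₗ.[ℂ] E) : Cardinal :=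
  Cardinal.sum fun t : Set.Iio (0 : ℝ) => Module.rank ℂ (eigenspace A ((t : ℝ) : ℂ))

end PadicSchrodinger

namespace PadicSchrodinger

/-! ### Measures of balls -/

/-! The Fourier transform diagonalises the problem coset by coset. The indicator of ℤ_p is its own
Fourier transform, so multiplication by V becomes convolution with σ 1_{ℤ_p}, which replaces a
function F on each coset c + ℤ_p by the constant σ ∫_{c+ℤ_p} F. Hence H becomes an orthogonal sum
over ℚ_p/ℤ_p of rank-one perturbations of multiplication by |ξ|^α.

For t < 0 the symbol |ξ|^α - t is positive. On each coset an eigenfunction must be a multiple of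
(|ξ|^α - t)⁻¹, and integrating over the coset shows that it can be nonzero there only if σ ∫_{c+ℤ_p}
(|ξ|^α - t)⁻¹ dm = 1. Conversely each solution gives an eigenfunction living on that coset alone
(`cosetCoeff_of_mem_eigenspace`, `exists_mem_eigenspace`, `rank_eigenspace`).

Off ℤ_p the norm is constant on the coset, so t = |c|^α - σ, which is negative iff |c|^α < σ. On ℤ_p
the integral is a series over spheres which increases strictly in t, from 0 at -∞ to the limit (p -
1)/(p - p^α) at 0 (infinite if α ≥ 1). A solution exists iff σ exceeds the reciprocal of this limit
(`exists_secular_eq_iff`), and it is unique. Every coset thus carries at most one negative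
eigenvalue, and Neg(H) counts the cosets that carry one (`negCount_schrodinger`).

The first threshold is below 1, and the others are at least p^α, which gives the first two claims.
If p^{nα} < σ ≤ p^{(n+1)α} with n ≥ 0, the count is that of the cosets with |c| ≤ p^n, namely p^n
(`CosetRep.mk_norm_le`). The integral of V^{1/α} is σ^{1/α}, which lies in (p^n, p^{n+1}]. -/

theorem natCast_norm_sub_lt_one {p : ℕ} [Fact p.Prime] {a b : ℕ} (ha : a < p) (hb : b < p)
    (h : ‖(a : ℚ_[p]) - b‖ < 1) : a = b := by
  have h' : ‖(((a : ℤ) - b : ℤ) : ℚ_[p])‖ < 1 := by push_cast; exact h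
  rw [Padic.norm_intCast_lt_one_iff] at h'
  have := Int.eq_zero_of_abs_lt_dvd h' (by rw [abs_lt]; lia)
  lia

theorem exists_natCast_norm_sub_lt_one {p : ℕ} [Fact p.Prime] {x : ℚ_[p]} (hx : ‖x‖ ≤ 1) :
    ∃ a < p, ‖x - (a : ℚ_[p])‖ < 1 := by
  obtain ⟨y, rfl⟩ : ∃ y : ℤ_[p], (y : ℚ_[p]) = x := ⟨⟨x, hx⟩, rfl⟩
  refine ⟨PadicInt.zmodRepr y, PadicInt.zmodRepr_lt_p _, ?_⟩
  have := PadicInt.sub_zmodRepr_mem y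
  rwa [IsLocalRing.mem_maximalIdeal, PadicInt.mem_nonunits, PadicInt.norm_def, PadicInt.coe_sub,
    PadicInt.coe_natCast] at this

theorem one_lt_prime_real (p : ℕ) [Fact p.Prime] : (1 : ℝ) < p := by
  exact_mod_cast (Fact.out : p.Prime).one_lt

theorem haar_closedBall (p : ℕ) [Fact p.Prime] (c : ℚ_[p]) (r : ℝ) :
    haar p (Metric.closedBall c r) = haar p (Metric.closedBall 0 r) := by
  rw [← measure_preimage_add_right (haar p) (-c) (Metric.closedBall 0 r)]
  congr 1
  ext x
  rw [Set.mem_preimage, mem_closedBall_zero_iff, Metric.mem_closedBall, dist_eq_norm,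
    sub_eq_add_neg]

theorem norm_lt_zpow_add_one_iff {p : ℕ} [Fact p.Prime] (x : ℚ_[p]) (k : ℤ) :
    ‖x‖ < (p : ℝ) ^ (k + 1) ↔ ‖x‖ ≤ (p : ℝ) ^ k :=
  (Padic.norm_le_pow_iff_norm_lt_pow_add_one x k).symm

/-- The larger ball is the disjoint union of p translates of the smaller one, with centres a
p^{-(k+1)} for the digits a < p; multiplying by p^{k+1} reduces this to residues modulo p. -/
theorem haar_closedBall_zpow_succ (p : ℕ) [Fact p.Prime] (k : ℤ) :
    haar p (Metric.closedBall 0 ((p : ℝ) ^ (k + 1))) =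
      p * haar p (Metric.closedBall 0 ((p : ℝ) ^ k)) := by
  have hp := one_lt_prime_real p
  have hp0 : (p : ℚ_[p]) ≠ 0 := by exact_mod_cast (Fact.out : p.Prime).ne_zero
  have hU : Metric.closedBall (0 : ℚ_[p]) ((p : ℝ) ^ (k + 1)) =
      ⋃ a ∈ Finset.range p, Metric.closedBall ((a : ℚ_[p]) * (p : ℚ_[p]) ^ (-(k + 1)))
        ((p : ℝ) ^ k) := by
    ext x
    rw [mem_closedBall_zero_iff]
    simp only [Set.mem_iUnion, Finset.mem_range, exists_prop, Metric.mem_closedBall, dist_eq_norm]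
    have key : ∀ a : ℕ, ‖x - (a : ℚ_[p]) * (p : ℚ_[p]) ^ (-(k + 1))‖ ≤ (p : ℝ) ^ k ↔
        ‖x * (p : ℚ_[p]) ^ (k + 1) - a‖ < 1 := fun a => by
      rw [← norm_lt_zpow_add_one_iff]
      have : x * (p : ℚ_[p]) ^ (k + 1) - a =
          (x - (a : ℚ_[p]) * (p : ℚ_[p]) ^ (-(k + 1))) * (p : ℚ_[p]) ^ (k + 1) := by
        rw [sub_mul, mul_assoc, ← zpow_add₀ hp0]; simp
      rw [this, norm_mul, Padic.norm_p_zpow, zpow_neg (p : ℝ), ← div_eq_mul_inv,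
        div_lt_one (by positivity)]
    simp only [key]
    have hx : ‖x‖ ≤ (p : ℝ) ^ (k + 1) ↔ ‖x * (p : ℚ_[p]) ^ (k + 1)‖ ≤ 1 := by
      rw [norm_mul, Padic.norm_p_zpow, zpow_neg, ← div_eq_mul_inv, div_le_one (by positivity)]
    rw [hx]
    refine ⟨exists_natCast_norm_sub_lt_one, fun ⟨a, _, ha⟩ => ?_⟩
    have := Padic.nonarchimedean (x * (p : ℚ_[p]) ^ (k + 1) - (a : ℚ_[p])) (a : ℚ_[p])
    rw [sub_add_cancel] at this
    exact this.trans (max_le ha.le (Padic.norm_int_le_one (a : ℤ)))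
  rw [hU, measure_biUnion_finset]
  · simp [haar_closedBall p (_ * _)]
  · intro a ha b hb hab
    refine Set.disjoint_left.2 fun x hxa hxb => hab ?_
    simp only [Finset.coe_range, Set.mem_Iio, Metric.mem_closedBall] at ha hb hxa hxb
    refine natCast_norm_sub_lt_one ha hb ?_
    have h1 := (dist_triangle_max _ x _).trans (max_le (dist_comm x _ ▸ hxa) hxb)
    rw [dist_eq_norm, ← sub_mul, norm_mul, Padic.norm_p_zpow, neg_neg] at h1
    have h2 : (p : ℝ) ^ k < (p : ℝ) ^ (k + 1) := zpow_lt_zpow_right₀ hp (by lia)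
    exact lt_of_mul_lt_mul_right ((h1.trans_lt h2).trans_eq (one_mul _).symm) (by positivity)
  · intro a _; exact measurableSet_closedBall

theorem haar_closedBall_zpow (p : ℕ) [Fact p.Prime] (c : ℚ_[p]) (k : ℤ) :
    haar p (Metric.closedBall c ((p : ℝ) ^ k)) = (p : ℝ≥0∞) ^ k := by
  have hp0 : (p : ℝ≥0∞) ≠ 0 := by exact_mod_cast (Fact.out : p.Prime).ne_zero
  have hpt : (p : ℝ≥0∞) ≠ ∞ := ENNReal.natCast_ne_top p
  rw [haar_closedBall]
  induction k using Int.induction_on with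
  | zero => simpa [integerBall_eq] using haar_integerBall p
  | succ n ih => rw [haar_closedBall_zpow_succ, ih, ENNReal.zpow_add hp0 hpt, zpow_one, mul_comm]
  | pred n ih =>
    have := haar_closedBall_zpow_succ p (-(n : ℤ) - 1)
    rw [sub_add_cancel, ih] at this
    rw [← ENNReal.mul_right_inj hp0 hpt, ← this, ENNReal.zpow_sub hp0 hpt, zpow_one, mul_comm,
      mul_assoc, ENNReal.inv_mul_cancel hp0 hpt, mul_one]

theorem haar_real_closedBall_zpow (p : ℕ) [Fact p.Prime] (c : ℚ_[p]) (k : ℤ) :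
    (haar p).real (Metric.closedBall c ((p : ℝ) ^ k)) = (p : ℝ) ^ k := by
  have hp : (p : NNReal) ≠ 0 := by exact_mod_cast (Fact.out : p.Prime).ne_zero
  have h : (p : ℝ≥0∞) ^ k = (((p : NNReal) ^ k : NNReal) : ℝ≥0∞) := by
    rw [ENNReal.coe_zpow hp]; simp
  rw [measureReal_def, haar_closedBall_zpow, h]
  simp

theorem haar_real_closedBall_one (p : ℕ) [Fact p.Prime] (c : ℚ_[p]) :
    (haar p).real (Metric.closedBall c 1) = 1 := by
  simpa using haar_real_closedBall_zpow p c 0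


/-! ### Test functions -/

section Test

variable {p : ℕ} [Fact p.Prime] {φ ψ : ℚ_[p] → ℂ}

theorem IsTest.integrable (h : IsTest φ) : Integrable φ (haar p) :=
  memLp_one_iff_integrable.1 (h.memLp 1)

theorem IsTest.add (h : IsTest φ) (h' : IsTest ψ) : IsTest (φ + ψ) :=
  ⟨h.1.add h'.1, h.2.add h'.2⟩

theorem IsTest.smul (c : ℂ) (h : IsTest φ) : IsTest (c • φ) :=
  ⟨h.1.comp (c • ·), h.2.smul_left⟩

theorem IsTest.conj (h : IsTest φ) : IsTest (fun x => (starRingEnd ℂ) (φ x)) :=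
  ⟨h.1.comp (starRingEnd ℂ), h.2.comp_left (map_zero _)⟩

theorem IsTest.zero : IsTest (0 : ℚ_[p] → ℂ) :=
  ⟨IsLocallyConstant.const 0, HasCompactSupport.zero⟩

theorem isLocallyConstant_indicator {f : ℚ_[p] → ℂ} (h : IsLocallyConstant f) {s : Set ℚ_[p]}
    (hs : IsClopen s) : IsLocallyConstant (s.indicator f) := by
  refine (IsLocallyConstant.iff_exists_open _).2 fun x => ?_
  obtain ⟨U, hU, hxU, hc⟩ := (IsLocallyConstant.iff_exists_open _).1 h x
  by_cases hx : x ∈ s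
  · exact ⟨U ∩ s, hU.inter hs.isOpen, ⟨hxU, hx⟩, fun y hy => by simp [hx, hy.2, hc y hy.1]⟩
  · exact ⟨sᶜ, hs.compl.isOpen, hx, fun y hy => by
      rw [Set.indicator_of_notMem hx, Set.indicator_of_notMem hy]⟩

theorem IsTest.indicator (h : IsTest φ) {s : Set ℚ_[p]} (hs : IsClopen s) :
    IsTest (s.indicator φ) :=
  ⟨isLocallyConstant_indicator h.1 hs,
    h.2.mono fun x hx => by
      by_contra h0
      exact hx (by by_cases hxs : x ∈ s <;> simp_all)⟩

theorem isTest_indicator_closedBall {f : ℚ_[p] → ℂ} (h : IsLocallyConstant f) (c : ℚ_[p]) {r : ℝ}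
    (hr : r ≠ 0) : IsTest ((Metric.closedBall c r).indicator f) :=
  ⟨isLocallyConstant_indicator h (IsUltrametricDist.isClopen_closedBall c hr),
    HasCompactSupport.intro (isCompact_closedBall c r) fun _ hx => Set.indicator_of_notMem hx _⟩

theorem exists_zpow_neg_lt (p : ℕ) [Fact p.Prime] {δ : ℝ} (hδ : 0 < δ) :
    ∃ N : ℕ, (p : ℝ) ^ (-(N : ℤ)) < δ := by
  have hp := one_lt_prime_real p
  obtain ⟨N, hN⟩ := exists_pow_lt_of_lt_one hδ (inv_lt_one_of_one_lt₀ hp)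
  exact ⟨N, by simpa using hN⟩

theorem IsTest.exists_support (h : IsTest φ) :
    ∃ N : ℕ, ∀ x, (p : ℝ) ^ N < ‖x‖ → φ x = 0 := by
  obtain ⟨R, hR⟩ := h.2.isBounded.subset_closedBall 0
  obtain ⟨N, hN⟩ := pow_unbounded_of_one_lt R (one_lt_prime_real p)
  refine ⟨N, fun x hx => image_eq_zero_of_notMem_tsupport fun hx' => ?_⟩
  have := hR hx'
  rw [mem_closedBall_zero_iff] at this
  linarith

/-- Compactness makes local constancy uniform: a Lebesgue number for the cover of the support by
fibres works when x or x + k is in the support, and otherwise both values vanish. -/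
theorem IsTest.exists_period (h : IsTest φ) :
    ∃ N : ℕ, ∀ x k : ℚ_[p], ‖k‖ ≤ (p : ℝ) ^ (-(N : ℤ)) → φ (x + k) = φ x := by
  obtain ⟨δ, hδ, hc⟩ := lebesgue_number_lemma_of_metric (s := tsupport φ) (c := fun z => φ ⁻¹' {z})
    h.2 (fun z => h.1.isOpen_fiber z) (fun x _ => Set.mem_iUnion.2 ⟨φ x, rfl⟩)
  obtain ⟨N, hN⟩ := exists_zpow_neg_lt p hδ
  refine ⟨N, fun x k hk => ?_⟩
  replace hk := hk.trans_lt hN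
  by_cases hx : x ∈ tsupport φ
  · obtain ⟨z, hz⟩ := hc x hx
    have h1 : φ (x + k) = z := hz (by simpa using hk)
    have h2 : φ x = z := hz (Metric.mem_ball_self hδ)
    rw [h1, h2]
  by_cases hx' : x + k ∈ tsupport φ
  · obtain ⟨z, hz⟩ := hc _ hx'
    have h1 : φ x = z := hz (by simpa [dist_eq_norm] using hk)
    have h2 : φ (x + k) = z := hz (Metric.mem_ball_self hδ)
    rw [h1, h2]
  rw [image_eq_zero_of_notMem_tsupport hx, image_eq_zero_of_notMem_tsupport hx']

end Test

/-! ### Fourier inversion on test functions -/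

/-- Continuous characters of `ℚ_p` which are trivial on `ℤ_p` but not on `p⁻¹ℤ_p`. -/
structure IsUnramified {p : ℕ} [Fact p.Prime] (e : AddChar ℚ_[p] Circle) : Prop where
  continuous : Continuous e
  eq_one : ∀ x : ℚ_[p], ‖x‖ ≤ 1 → e x = 1
  inv_ne_one : e (p : ℚ_[p])⁻¹ ≠ 1

theorem isUnramified_stdChar (p : ℕ) [Fact p.Prime] : IsUnramified (stdChar p) :=
  ⟨continuous_stdChar p, fun _ => stdChar_eq_one p, stdChar_inv_ne_one p⟩

theorem IsUnramified.inv {p : ℕ} [Fact p.Prime] {e : AddChar ℚ_[p] Circle} (h : IsUnramified e) :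
    IsUnramified e⁻¹ := by
  refine ⟨?_, fun x hx => ?_, ?_⟩
  · have : Continuous fun x => e (-x) := h.continuous.comp continuous_neg
    exact this
  · rw [AddChar.inv_apply, h.eq_one _ (by simpa using hx)]
  · rw [AddChar.inv_apply', _root_.inv_ne_one]; exact h.inv_ne_one

section Fourier

variable {p : ℕ} [Fact p.Prime] {e : AddChar ℚ_[p] Circle} {φ : ℚ_[p] → ℂ}

theorem fourierIntegral_apply (e : AddChar ℚ_[p] Circle) (f : ℚ_[p] → ℂ) (ξ : ℚ_[p]) :
    Fourier.fourierIntegral e (haar p) f ξ = ∫ x, (e (-(x * ξ)) : ℂ) * f x ∂haar p := rfl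

theorem IsUnramified.apply_add (h : IsUnramified e) {x k : ℚ_[p]} (hk : ‖k‖ ≤ 1) :
    e (x + k) = e x := by
  rw [AddChar.map_add_eq_mul, h.eq_one k hk, mul_one]

/-- If φ is supported in |x| ≤ p^N, moving the frequency by at most p^{-N} changes the phase by a
character value on ℤ_p, which is 1. So the transform is locally constant. -/
theorem IsTest.fourierIntegral (h : IsTest φ) (he : IsUnramified e) :
    IsTest (Fourier.fourierIntegral e (haar p) φ) := by
  refine ⟨?_, (h.fourier he.continuous he.inv_ne_one).2⟩
  obtain ⟨N, hN⟩ := h.exists_support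
  have hp := one_lt_prime_real p
  refine (IsLocallyConstant.iff_exists_open _).2 fun ξ =>
    ⟨Metric.closedBall ξ ((p : ℝ) ^ (-(N : ℤ))),
      (IsUltrametricDist.isClopen_closedBall ξ (by positivity)).isOpen,
      Metric.mem_closedBall_self (by positivity), fun η hη => ?_⟩
  simp only [fourierIntegral_apply]
  refine integral_congr_ae (Filter.Eventually.of_forall fun x => ?_)
  dsimp only
  by_cases hx : (p : ℝ) ^ N < ‖x‖
  · simp [hN x hx]
  · have : -(x * η) = -(x * ξ) + -(x * (η - ξ)) := by ring
    rw [this, he.apply_add]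
    rw [norm_neg, norm_mul]
    rw [Metric.mem_closedBall, dist_eq_norm] at hη
    calc ‖x‖ * ‖η - ξ‖ ≤ (p : ℝ) ^ N * (p : ℝ) ^ (-(N : ℤ)) := by
          gcongr; exact not_lt.1 hx
      _ = 1 := by rw [zpow_neg, zpow_natCast]; exact mul_inv_cancel₀ (by positivity)

/-- Orthogonality relations on balls. -/
theorem IsUnramified.integral_closedBall (he : IsUnramified e) (N : ℤ) (z : ℚ_[p]) :
    ∫ ξ in Metric.closedBall 0 ((p : ℝ) ^ N), (e (z * ξ) : ℂ) ∂haar p =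
      (Metric.closedBall (0 : ℚ_[p]) ((p : ℝ) ^ (-N))).indicator (fun _ => ((p : ℝ) ^ N : ℂ)) z := by
  have hp := one_lt_prime_real p
  by_cases hz : ‖z‖ ≤ (p : ℝ) ^ (-N)
  · rw [Set.indicator_of_mem (by simpa using hz)]
    have : ∀ ξ ∈ Metric.closedBall (0 : ℚ_[p]) ((p : ℝ) ^ N), (e (z * ξ) : ℂ) = 1 := by
      intro ξ hξ
      rw [mem_closedBall_zero_iff] at hξ
      rw [he.eq_one, Circle.coe_one]
      calc ‖z * ξ‖ = ‖z‖ * ‖ξ‖ := norm_mul _ _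
        _ ≤ (p : ℝ) ^ (-N) * (p : ℝ) ^ N := by gcongr
        _ = 1 := by rw [zpow_neg]; exact inv_mul_cancel₀ (by positivity)
    rw [setIntegral_congr_fun measurableSet_closedBall this, setIntegral_const,
      haar_real_closedBall_zpow]
    simp
  · rw [Set.indicator_of_notMem (by simpa using hz)]
    rw [not_le] at hz
    have hz0 : z ≠ 0 := norm_pos_iff.1 (lt_trans (by positivity) hz)
    -- Translation by this point preserves the ball and multiplies the integrand by `e p⁻¹`, which
    -- is not 1; so the integral vanishes.
    set ξ₀ : ℚ_[p] := (p : ℚ_[p])⁻¹ * z⁻¹ with hξ₀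
    have hn : ‖ξ₀‖ ≤ (p : ℝ) ^ N := by
      rw [← norm_lt_zpow_add_one_iff, hξ₀, norm_mul, norm_inv, norm_inv, Padic.norm_p, inv_inv,
        zpow_add₀ (by positivity), zpow_one, mul_comm]
      rw [zpow_neg] at hz
      gcongr
      exact inv_lt_of_inv_lt₀ (by positivity) hz
    rw [← integral_indicator measurableSet_closedBall]
    have hint : ∫ ξ, (Metric.closedBall 0 ((p : ℝ) ^ N)).indicator
          (fun ξ => (e (z * ξ) : ℂ)) ξ ∂haar p =
        (e (p : ℚ_[p])⁻¹ : ℂ) * ∫ ξ, (Metric.closedBall 0 ((p : ℝ) ^ N)).indicator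
          (fun ξ => (e (z * ξ) : ℂ)) ξ ∂haar p := by
      conv_lhs => rw [← integral_add_right_eq_self _ ξ₀]
      rw [← integral_const_mul]
      refine integral_congr_ae (Filter.Eventually.of_forall fun ξ => ?_)
      dsimp only
      have hiff : ξ + ξ₀ ∈ Metric.closedBall (0 : ℚ_[p]) ((p : ℝ) ^ N) ↔
          ξ ∈ Metric.closedBall (0 : ℚ_[p]) ((p : ℝ) ^ N) := by
        simp only [mem_closedBall_zero_iff]
        refine ⟨fun h => ?_, fun h => (Padic.nonarchimedean _ _).trans (max_le h hn)⟩
        have := (Padic.nonarchimedean (ξ + ξ₀) (-ξ₀)).trans (max_le h (by rwa [norm_neg]))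
        simpa using this
      by_cases hξ : ξ ∈ Metric.closedBall (0 : ℚ_[p]) ((p : ℝ) ^ N)
      · rw [Set.indicator_of_mem hξ, Set.indicator_of_mem (hiff.2 hξ)]
        have : z * (ξ + ξ₀) = (p : ℚ_[p])⁻¹ + z * ξ := by rw [hξ₀]; field_simp; ring
        rw [this, AddChar.map_add_eq_mul, Circle.coe_mul]
      · rw [Set.indicator_of_notMem hξ, Set.indicator_of_notMem (fun h => hξ (hiff.1 h)), mul_zero]
    by_contra hne
    refine he.inv_ne_one (Circle.ext ?_)
    simpa using mul_right_cancel₀ hne ((one_mul _).trans hint).symm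

theorem IsUnramified.integral_fourierIntegral_mul (he : IsUnramified e) {f g : ℚ_[p] → ℂ}
    (hf : Integrable f (haar p)) (hg : Integrable g (haar p)) :
    ∫ ξ, Fourier.fourierIntegral e (haar p) f ξ * g ξ ∂haar p =
      ∫ x, f x * Fourier.fourierIntegral e (haar p) g x ∂haar p := by
  have := VectorFourier.integral_fourierIntegral_smul_eq_flip (L := LinearMap.mul ℚ_[p] ℚ_[p])
    he.continuous (by exact continuous_mul) hf hg
  -- The kernel is symmetric in x and ξ, so the flipped transform is the same transform.
  have hflip : (LinearMap.mul ℚ_[p] ℚ_[p]).flip = LinearMap.mul ℚ_[p] ℚ_[p] := by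
    ext; simp
  rw [hflip] at this
  exact this

/-- The outer integral may be cut off to |ξ| ≤ p^N, where N exceeds the support exponent of the
transform. Fubini moves the transform onto the cut-off character, which becomes p^N times the
indicator of the ball of radius p^{-N} about x. N also exceeds the period exponent of φ, so φ is
constant on that ball, whose measure cancels p^N. -/
theorem IsTest.fourier_inversion (h : IsTest φ) (he : IsUnramified e) :
    Fourier.fourierIntegral e⁻¹ (haar p) (Fourier.fourierIntegral e (haar p) φ) = φ := by
  have hp := one_lt_prime_real p
  obtain ⟨M, hM⟩ := (h.fourierIntegral he).exists_support
  obtain ⟨K, hK⟩ := h.exists_period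
  set N : ℕ := max M K with hN
  ext x
  set g : ℚ_[p] → ℂ := (Metric.closedBall 0 ((p : ℝ) ^ (N : ℤ))).indicator
    (fun ξ => (e (x * ξ) : ℂ)) with hg
  have hgi : Integrable g (haar p) := by
    rw [hg, integrable_indicator_iff measurableSet_closedBall]
    refine ContinuousOn.integrableOn_compact (isCompact_closedBall _ _) ?_
    exact (continuous_subtype_val.comp
      (he.continuous.comp (continuous_const.mul continuous_id))).continuousOn
  have h1 : Fourier.fourierIntegral e⁻¹ (haar p) (Fourier.fourierIntegral e (haar p) φ) x =
      ∫ ξ, Fourier.fourierIntegral e (haar p) φ ξ * g ξ ∂haar p := by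
    rw [fourierIntegral_apply]
    refine integral_congr_ae (Filter.Eventually.of_forall fun ξ => ?_)
    dsimp only
    by_cases hξ : ‖ξ‖ ≤ (p : ℝ) ^ (N : ℤ)
    · rw [hg, Set.indicator_of_mem (by simpa using hξ), mul_comm, AddChar.inv_apply, neg_neg,
        mul_comm ξ]
    · rw [hM ξ, mul_zero, zero_mul]
      refine lt_of_le_of_lt ?_ (not_le.1 hξ)
      rw [zpow_natCast]
      exact pow_le_pow_right₀ hp.le (le_max_left _ _)
  have h2 : ∀ y, Fourier.fourierIntegral e (haar p) g y =
      (Metric.closedBall x ((p : ℝ) ^ (-(N : ℤ)))).indicator (fun _ => ((p : ℝ) ^ (N : ℤ) : ℂ)) y := by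
    intro y
    have := he.integral_closedBall N (x - y)
    rw [← integral_indicator measurableSet_closedBall] at this
    rw [fourierIntegral_apply]
    refine Eq.trans ?_ (this.trans ?_)
    · refine integral_congr_ae (Filter.Eventually.of_forall fun ξ => ?_)
      dsimp only
      by_cases hξ : ξ ∈ Metric.closedBall (0 : ℚ_[p]) ((p : ℝ) ^ (N : ℤ))
      · rw [hg, Set.indicator_of_mem hξ, Set.indicator_of_mem hξ, ← Circle.coe_mul,
          ← AddChar.map_add_eq_mul]
        congr 2; ring
      · rw [hg, Set.indicator_of_notMem hξ, Set.indicator_of_notMem hξ, mul_zero]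
    · have : x - y ∈ Metric.closedBall (0 : ℚ_[p]) ((p : ℝ) ^ (-(N : ℤ))) ↔
          y ∈ Metric.closedBall x ((p : ℝ) ^ (-(N : ℤ))) := by
        rw [mem_closedBall_zero_iff, Metric.mem_closedBall, dist_comm, dist_eq_norm]
      by_cases hy : y ∈ Metric.closedBall x ((p : ℝ) ^ (-(N : ℤ)))
      · rw [Set.indicator_of_mem hy, Set.indicator_of_mem (this.2 hy)]
      · rw [Set.indicator_of_notMem hy, Set.indicator_of_notMem (fun h => hy (this.1 h))]
  rw [h1, he.integral_fourierIntegral_mul h.integrable hgi]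
  simp only [h2]
  have h3 : ∀ y, φ y * (Metric.closedBall x ((p : ℝ) ^ (-(N : ℤ)))).indicator
      (fun _ => ((p : ℝ) ^ (N : ℤ) : ℂ)) y = (Metric.closedBall x ((p : ℝ) ^ (-(N : ℤ)))).indicator
      (fun _ => φ x * ((p : ℝ) ^ (N : ℤ) : ℂ)) y := by
    intro y
    by_cases hy : y ∈ Metric.closedBall x ((p : ℝ) ^ (-(N : ℤ)))
    · rw [Set.indicator_of_mem hy, Set.indicator_of_mem hy]
      have := hK x (y - x) (by
        rw [← dist_eq_norm]
        refine (Metric.mem_closedBall.1 hy).trans ?_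
        exact zpow_le_zpow_right₀ hp.le (by simp [hN]))
      rw [← this, add_sub_cancel]
    · rw [Set.indicator_of_notMem hy, Set.indicator_of_notMem hy, mul_zero]
  simp only [h3]
  rw [integral_indicator measurableSet_closedBall, setIntegral_const, haar_real_closedBall_zpow]
  have : ((p : ℝ) : ℂ) ≠ 0 := by exact_mod_cast (by positivity : (p : ℝ) ≠ 0)
  rw [Complex.real_smul, Complex.ofReal_zpow, zpow_neg]
  field_simp

end Fourier

/-! ### The Fourier transform on `L²` -/

section FourierL2

variable {p : ℕ} [Fact p.Prime] {e : AddChar ℚ_[p] Circle}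

theorem integral_mul_eq_inner (f : L2 p) {ψ : ℚ_[p] → ℂ} (h : MemLp ψ 2 (haar p)) :
    ∫ x, f x * ψ x ∂haar p = inner ℂ (h.star.toLp (star ψ)) f := by
  rw [L2.inner_def]
  refine integral_congr_ae ?_
  filter_upwards [h.star.coeFn_toLp] with x hx
  rw [hx, RCLike.inner_apply]
  simp

/-- The space of test functions. -/
def testSpace (p : ℕ) [Fact p.Prime] : Submodule ℂ (ℚ_[p] → ℂ) where
  carrier := {φ | IsTest φ}
  zero_mem' := IsTest.zero
  add_mem' := IsTest.add
  smul_mem' c _ h := IsTest.smul c h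

/-- The inclusion of the test functions into `L²`. -/
noncomputable def testToLp (p : ℕ) [Fact p.Prime] : testSpace p →ₗ[ℂ] L2 p where
  toFun φ := (IsTest.memLp φ.2 2).toLp φ
  map_add' φ ψ := MemLp.toLp_add (IsTest.memLp φ.2 2) (IsTest.memLp ψ.2 2)
  map_smul' c φ := MemLp.toLp_const_smul c (IsTest.memLp φ.2 2)

/-- The Fourier transform of test functions, as functions in `L²`. -/
noncomputable def testFourier (he : IsUnramified e) : testSpace p →ₗ[ℂ] L2 p where
  toFun φ := ((IsTest.fourierIntegral φ.2 he).memLp 2).toLp _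
  map_add' φ ψ := by
    rw [← MemLp.toLp_add]
    congr 1
    exact VectorFourier.fourierIntegral_add he.continuous (by exact continuous_mul)
      (IsTest.integrable φ.2) (IsTest.integrable ψ.2)
  map_smul' c φ := by
    rw [RingHom.id_apply, ← MemLp.toLp_const_smul]
    congr 1
    exact Fourier.fourierIntegral_const_smul e (haar p) φ.1 c

theorem coeFn_testToLp (φ : testSpace p) : testToLp p φ =ᵐ[haar p] φ.1 :=
  MemLp.coeFn_toLp (IsTest.memLp φ.2 2)

theorem coeFn_testFourier (he : IsUnramified e) (φ : testSpace p) :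
    testFourier he φ =ᵐ[haar p] Fourier.fourierIntegral e (haar p) φ.1 :=
  MemLp.coeFn_toLp ((IsTest.fourierIntegral φ.2 he).memLp 2)

theorem denseRange_testToLp (p : ℕ) [Fact p.Prime] : DenseRange (testToLp p) := by
  have h : (LinearMap.range (testToLp p))ᗮ = ⊥ := by
    rw [Submodule.eq_bot_iff]
    intro f hf
    refine eq_zero_of_forall_test f fun φ hφ => ?_
    rw [integral_mul_eq_inner f (hφ.memLp 2)]
    exact (Submodule.mem_orthogonal _ f).1 hf _ ⟨⟨star φ, hφ.conj⟩, rfl⟩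
  rw [← Submodule.topologicalClosure_eq_top_iff, ← SetLike.coe_set_eq,
    Submodule.topologicalClosure_coe] at h
  exact dense_iff_closure_eq.2 h

/-- Plancherel: the conjugate of the transform is the inverse-character transform of the conjugate,
so the multiplication formula followed by inversion gives equality of the norms. -/
theorem norm_testFourier (he : IsUnramified e) (φ : testSpace p) :
    ‖testFourier he φ‖ = ‖testToLp p φ‖ := by
  have hφ : IsTest (φ : ℚ_[p] → ℂ) := φ.2
  have key : ∫ ξ, Fourier.fourierIntegral e (haar p) φ ξ *
      (starRingEnd ℂ) (Fourier.fourierIntegral e (haar p) φ ξ) ∂haar p =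
      ∫ x, φ.1 x * (starRingEnd ℂ) (φ.1 x) ∂haar p := by
    have hconj : (fun ξ => (starRingEnd ℂ) (Fourier.fourierIntegral e (haar p) φ ξ)) =
        Fourier.fourierIntegral e⁻¹ (haar p) (fun x => (starRingEnd ℂ) (φ.1 x)) := by
      ext ξ
      rw [fourierIntegral_apply, fourierIntegral_apply, ← integral_conj]
      refine integral_congr_ae (Filter.Eventually.of_forall fun x => ?_)
      dsimp only
      rw [map_mul, ← Circle.coe_inv_eq_conj, AddChar.inv_apply']
    have hinv := hφ.conj.fourier_inversion he.inv
    rw [inv_inv, ← hconj] at hinv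
    rw [he.integral_fourierIntegral_mul hφ.integrable (hφ.fourierIntegral he).conj.integrable, hinv]
  have hsq : ‖testFourier he φ‖ ^ 2 = ‖testToLp p φ‖ ^ 2 := by
    have h1 : inner ℂ (testFourier he φ) (testFourier he φ) =
        inner ℂ (testToLp p φ) (testToLp p φ) := by
      rw [L2.inner_def, L2.inner_def]
      refine Eq.trans ?_ (key.trans ?_)
      · refine integral_congr_ae ?_
        filter_upwards [coeFn_testFourier he φ] with x hx
        rw [hx, RCLike.inner_apply]
      · refine integral_congr_ae ?_
        filter_upwards [coeFn_testToLp φ] with x hx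
        rw [hx, RCLike.inner_apply]
    rw [inner_self_eq_norm_sq_to_K, inner_self_eq_norm_sq_to_K] at h1
    exact_mod_cast h1
  exact (sq_eq_sq₀ (norm_nonneg _) (norm_nonneg _)).1 hsq

/-- Test functions are dense and their transform is isometric, so it extends to L². The duality
identity holds for test functions by Fubini and is closed in f. -/
theorem exists_fourierL2 (he : IsUnramified e) (f : L2 p) : ∃ g : L2 p,
    ∀ φ : ℚ_[p] → ℂ, IsTest φ → ∫ x, g x * φ x ∂haar p =
      ∫ x, f x * Fourier.fourierIntegral e (haar p) φ x ∂haar p := by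
  set T := (testFourier he).extendOfNorm (testToLp p) with hT
  refine ⟨T f, fun φ hφ => ?_⟩
  have h1 := hφ.memLp 2
  have h2 := (hφ.fourierIntegral he).memLp 2
  rw [integral_mul_eq_inner _ h1, integral_mul_eq_inner _ h2]
  refine (denseRange_testToLp p).induction_on
    (p := fun f => inner ℂ (h1.star.toLp (star φ)) (T f) = inner ℂ (h2.star.toLp _) f) f
    (isClosed_eq (by fun_prop) (by fun_prop)) fun ψ => ?_
  have hψ : IsTest (ψ : ℚ_[p] → ℂ) := ψ.2
  rw [hT, LinearMap.extendOfNorm_eq (denseRange_testToLp p)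
    ⟨1, fun x => by rw [norm_testFourier, one_mul]⟩, ← integral_mul_eq_inner _ h1,
    ← integral_mul_eq_inner _ h2]
  refine Eq.trans ?_ ((he.integral_fourierIntegral_mul hψ.integrable hφ.integrable).trans ?_)
  · refine integral_congr_ae ?_
    filter_upwards [coeFn_testFourier he ψ] with x hx
    rw [hx]
  · refine integral_congr_ae ?_
    filter_upwards [coeFn_testToLp ψ] with x hx
    rw [hx]

/-- The transform of a test function is again a test function, so it can be fed into the duality
relation and inverted. -/
theorem IsFourierInv.isFourier {f g : L2 p} (h : IsFourierInv f g) : IsFourier g f := by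
  intro φ hφ
  have he := isUnramified_stdChar p
  rw [h _ (hφ.fourierIntegral he), hφ.fourier_inversion he]

theorem IsFourier.isFourierInv {f g : L2 p} (h : IsFourier f g) : IsFourierInv g f := by
  intro φ hφ
  have he := isUnramified_stdChar p
  have := hφ.fourier_inversion he.inv
  rw [inv_inv] at this
  rw [h _ (hφ.fourierIntegral he.inv), this]

theorem exists_isFourierInv (F : L2 p) : ∃ f : L2 p, IsFourierInv F f :=
  exists_fourierL2 (isUnramified_stdChar p).inv F

theorem L2.eq_of_forall_test {f g : L2 p}
    (h : ∀ φ : ℚ_[p] → ℂ, IsTest φ → ∫ x, f x * φ x ∂haar p = ∫ x, g x * φ x ∂haar p) : f = g := by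
  rw [← sub_eq_zero]
  refine eq_zero_of_forall_test _ fun φ hφ => ?_
  rw [sub_eq_add_neg, ← neg_one_smul ℂ g, integral_add_mul _ _ (hφ.memLp 2), integral_smul_mul,
    h φ hφ]
  ring

theorem IsFourierInv.unique {f F F' : L2 p} (h : IsFourierInv f F) (h' : IsFourierInv f F') :
    F = F' :=
  L2.eq_of_forall_test fun φ hφ => (h φ hφ).trans (h' φ hφ).symm

theorem IsFourier.add {f g F G : L2 p} (h : IsFourier f F) (h' : IsFourier g G) :
    IsFourier (f + g) (F + G) := fun φ hφ => by
  rw [integral_add_mul _ _ (hφ.memLp 2), integral_add_mul _ _ hφ.memLp_fourier, h φ hφ, h' φ hφ]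

theorem IsFourier.smul (c : ℂ) {f F : L2 p} (h : IsFourier f F) :
    IsFourier (c • f) (c • F) := fun φ hφ => by
  rw [integral_smul_mul, integral_smul_mul, h φ hφ]

end FourierL2

section Eigen

variable {p : ℕ} [Fact p.Prime] {e : AddChar ℚ_[p] Circle}

/-! ### Functions on a coset of `ℤ_p` -/

/-- The indicator function of the coset `c + ℤ_p`. -/
noncomputable def cosetIndicator (c : ℚ_[p]) : ℚ_[p] → ℂ :=
  (Metric.closedBall c 1).indicator fun _ => 1

theorem isTest_cosetIndicator (c : ℚ_[p]) : IsTest (cosetIndicator c) :=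
  isTest_indicator_closedBall (IsLocallyConstant.const 1) c one_ne_zero

theorem cosetIndicator_of_mem {c ξ : ℚ_[p]} (h : ξ ∈ Metric.closedBall c 1) :
    cosetIndicator c ξ = 1 := Set.indicator_of_mem h _

theorem cosetIndicator_of_notMem {c ξ : ℚ_[p]} (h : ξ ∉ Metric.closedBall c 1) :
    cosetIndicator c ξ = 0 := Set.indicator_of_notMem h _

/-- ℤ_p is its own annihilator; this inclusion makes frequencies in one coset of ℤ_p
indistinguishable on functions supported in ℤ_p. -/
theorem IsUnramified.apply_mul_eq (he : IsUnramified e) {c ξ x : ℚ_[p]}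
    (hξ : ξ ∈ Metric.closedBall c 1) (hx : ‖x‖ ≤ 1) : e (-(x * ξ)) = e (-(x * c)) := by
  have : -(x * ξ) = -(x * c) + -(x * (ξ - c)) := by ring
  rw [this, he.apply_add]
  rw [Metric.mem_closedBall, dist_eq_norm] at hξ
  rw [norm_neg, norm_mul]
  exact mul_le_one₀ hx (norm_nonneg _) hξ

theorem IsUnramified.fourierIntegral_cosetIndicator (he : IsUnramified e) (c x : ℚ_[p]) :
    Fourier.fourierIntegral e (haar p) (cosetIndicator c) x =
      (e (-(x * c)) : ℂ) * cosetIndicator 0 x := by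
  have h := he.integral_closedBall 0 (-x)
  rw [neg_zero, zpow_zero, ← integral_indicator measurableSet_closedBall] at h
  have hx : (Metric.closedBall (0 : ℚ_[p]) 1).indicator (fun _ => (((p : ℝ) : ℂ) ^ (0 : ℤ))) (-x) =
      cosetIndicator 0 x := by
    by_cases hx : ‖x‖ ≤ 1
    · rw [cosetIndicator_of_mem (by simpa using hx), Set.indicator_of_mem (by simpa using hx),
        zpow_zero]
    · rw [cosetIndicator_of_notMem (by simpa using hx),
        Set.indicator_of_notMem (by simpa using hx)]
  rw [← hx, ← h, fourierIntegral_apply, ← integral_const_mul, ← integral_add_right_eq_self _ c]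
  refine integral_congr_ae (Filter.Eventually.of_forall fun ξ => ?_)
  dsimp only
  by_cases hξ : ‖ξ‖ ≤ 1
  · rw [cosetIndicator_of_mem (by simpa [dist_eq_norm] using hξ),
      Set.indicator_of_mem (by simpa using hξ), mul_one, ← Circle.coe_mul,
      ← AddChar.map_add_eq_mul]
    congr 2; ring
  · rw [cosetIndicator_of_notMem (by simpa [dist_eq_norm] using hξ),
      Set.indicator_of_notMem (by simpa using hξ), mul_zero, mul_zero]

theorem IsUnramified.fourierIntegral_of_support (he : IsUnramified e) {φ : ℚ_[p] → ℂ} {c : ℚ_[p]}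
    (hφ : ∀ ξ ∉ Metric.closedBall c 1, φ ξ = 0) {x : ℚ_[p]} (hx : ‖x‖ ≤ 1) :
    Fourier.fourierIntegral e (haar p) φ x = (e (-(x * c)) : ℂ) * ∫ ξ, φ ξ ∂haar p := by
  rw [fourierIntegral_apply, ← integral_const_mul]
  refine integral_congr_ae (Filter.Eventually.of_forall fun ξ => ?_)
  dsimp only
  by_cases hξ : ξ ∈ Metric.closedBall c 1
  · rw [mul_comm ξ, he.apply_mul_eq hξ hx]
  · rw [hφ ξ hξ, mul_zero, mul_zero]

theorem IsUnramified.fourierIntegral_congr_coset (he : IsUnramified e) {φ : ℚ_[p] → ℂ}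
    (hφ : ∀ x ∉ Metric.closedBall (0 : ℚ_[p]) 1, φ x = 0) {c ξ : ℚ_[p]}
    (hξ : ξ ∈ Metric.closedBall c 1) :
    Fourier.fourierIntegral e (haar p) φ ξ = Fourier.fourierIntegral e (haar p) φ c := by
  rw [fourierIntegral_apply, fourierIntegral_apply]
  refine integral_congr_ae (Filter.Eventually.of_forall fun x => ?_)
  dsimp only
  by_cases hx : x ∈ Metric.closedBall (0 : ℚ_[p]) 1
  · rw [he.apply_mul_eq hξ (by simpa using hx)]
  · rw [hφ x hx, mul_zero, mul_zero]

theorem potential_eq (σ : ℝ) (x : ℚ_[p]) :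
    (potential p σ x : ℂ) = σ * cosetIndicator 0 x := by
  by_cases hx : ‖x‖ ≤ 1
  · rw [cosetIndicator_of_mem (by simpa using hx), potential, Set.indicator_of_mem (by exact hx),
      mul_one]
  · rw [cosetIndicator_of_notMem (by simpa using hx), potential,
      Set.indicator_of_notMem (by exact hx), mul_zero, Complex.ofReal_zero]

theorem integral_potentialOp_mul (σ : ℝ) (f : L2 p) (ψ : ℚ_[p] → ℂ) :
    ∫ x, potentialOp p σ f x * ψ x ∂haar p =
      ∫ x, f x * (σ * (cosetIndicator 0 x * ψ x)) ∂haar p := by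
  refine integral_congr_ae ?_
  filter_upwards [(memLp_potential_mul σ f).coeFn_toLp] with x hx
  change (MemLp.toLp _ (memLp_potential_mul σ f) : L2 p) x * _ = _
  rw [hx, potential_eq]
  ring

/-! ### Coefficients of an `L²` function -/

/-- The integral of `𝓕 f` over the coset `c + ℤ_p`. -/
noncomputable def cosetCoeff (c : ℚ_[p]) : L2 p →ₗ[ℂ] ℂ where
  toFun f := ∫ x, f x * Fourier.fourierIntegral (stdChar p) (haar p) (cosetIndicator c) x ∂haar p
  map_add' f g := integral_add_mul f g (isTest_cosetIndicator c).memLp_fourier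
  map_smul' a f := integral_smul_mul a f _

theorem IsFourier.cosetCoeff_eq {f F : L2 p} (h : IsFourier f F) (c : ℚ_[p]) :
    cosetCoeff c f = ∫ ξ, F ξ * cosetIndicator c ξ ∂haar p :=
  (h _ (isTest_cosetIndicator c)).symm

/-- The Fourier transform of a function supported in `ℤ_p` is constant on cosets of `ℤ_p`. -/
theorem ae_eq_of_isFourier_potentialOp {σ : ℝ} {f U : L2 p} (h : IsFourier (potentialOp p σ f) U)
    (c : ℚ_[p]) :
    ∀ᵐ ξ ∂haar p, ξ ∈ Metric.closedBall c 1 → U ξ = σ * cosetCoeff c f := by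
  have he := isUnramified_stdChar p
  have hV := (isTest_cosetIndicator c).smul (σ * cosetCoeff c f)
  have hW : MemLp (fun ξ => (Metric.closedBall c 1).indicator U ξ -
      (σ * cosetCoeff c f) * cosetIndicator c ξ) 2 (haar p) :=
    ((Lp.memLp U).indicator measurableSet_closedBall).sub (hV.memLp 2)
  have h0 : hW.toLp _ = 0 := by
    refine eq_zero_of_forall_test _ fun φ hφ => ?_
    have hφc : IsTest ((Metric.closedBall c 1).indicator φ) :=
      hφ.indicator (IsUltrametricDist.isClopen_closedBall c one_ne_zero)
    -- On ℤ_p the transform of φ cut to the coset is the phase e(-xc) times the integral of the cut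
    -- φ, and the transform of the coset indicator is that same phase. Off ℤ_p the potential kills
    -- both sides.
    have h1 : ∫ ξ, U ξ * (Metric.closedBall c 1).indicator φ ξ ∂haar p =
        σ * cosetCoeff c f * ∫ ξ, (Metric.closedBall c 1).indicator φ ξ ∂haar p := by
      rw [h _ hφc, integral_potentialOp_mul]
      change _ = σ * (∫ x, f x * Fourier.fourierIntegral (stdChar p) (haar p)
        (cosetIndicator c) x ∂haar p) * _
      rw [mul_comm (σ : ℂ), mul_assoc, ← integral_mul_const]
      refine integral_congr_ae (Filter.Eventually.of_forall fun x => ?_)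
      dsimp only
      rw [he.fourierIntegral_cosetIndicator]
      by_cases hx : ‖x‖ ≤ 1
      · rw [he.fourierIntegral_of_support (fun ξ hξ => Set.indicator_of_notMem hξ _) hx]
        ring
      · rw [cosetIndicator_of_notMem (by simpa using hx)]
        ring
    rw [← sub_eq_zero, ← integral_const_mul, ← integral_sub (integrable_mul U (hφc.memLp 2))
      (hφc.integrable.const_mul _)] at h1
    rw [← h1]
    refine integral_congr_ae ?_
    filter_upwards [hW.coeFn_toLp] with ξ hξ
    rw [hξ]
    by_cases hc : ξ ∈ Metric.closedBall c 1
    · simp only [Set.indicator_of_mem hc, cosetIndicator_of_mem hc]; ring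
    · simp only [Set.indicator_of_notMem hc, cosetIndicator_of_notMem hc]; ring
  have h2 := hW.coeFn_toLp
  rw [h0] at h2
  filter_upwards [h2, Lp.coeFn_zero ℂ 2 (haar p)] with ξ h3 h4 hc
  rw [h4, Set.indicator_of_mem hc, cosetIndicator_of_mem hc, mul_one] at h3
  exact sub_eq_zero.1 h3.symm

/-! ### The eigenspaces -/

/-- This is 𝔇^α f = V f + t f on the Fourier side, with U the transform of V f. No separate domain
condition is needed: |ξ|^α F = U + tF is automatically in L². -/
theorem mem_eigenspace_schrodinger (α σ : ℝ) (t : ℂ) (f : L2 p) :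
    f ∈ eigenspace (schrodinger p α σ) t ↔ ∃ F U : L2 p, IsFourier f F ∧
      IsFourier (potentialOp p σ f) U ∧
      ∀ᵐ ξ ∂haar p, U ξ = (((‖ξ‖ ^ α : ℝ) : ℂ) - t) * F ξ := by
  have h1 : f ∈ eigenspace (schrodinger p α σ) t ↔
      (f, potentialOp p σ f + t • f) ∈ vladimirovGraph p α := by
    rw [mem_eigenspace, ← vladimirov_graph, LinearPMap.mem_graph_iff]
    constructor
    · rintro ⟨hf, h⟩
      refine ⟨⟨f, hf⟩, rfl, ?_⟩
      rw [← h]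
      change _ = potentialOp p σ f + (-(potentialOp p σ f) + vladimirov p α ⟨f, hf⟩)
      abel
    · rintro ⟨⟨f', hf⟩, rfl, h⟩
      refine ⟨hf, ?_⟩
      change -(potentialOp p σ f') + vladimirov p α ⟨f', hf⟩ = _
      rw [h]
      simp
  rw [h1]
  constructor
  · rintro ⟨F, G, hF, hG, hh⟩
    refine ⟨F, G + (-t) • F, hF, ?_, ?_⟩
    · have := hh.isFourier.add (hF.smul (-t))
      simpa [add_assoc] using this
    · filter_upwards [hG, Lp.coeFn_add G ((-t) • F), Lp.coeFn_smul (-t) F] with ξ h2 h3 h4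
      rw [h3, Pi.add_apply, h4, Pi.smul_apply, h2, smul_eq_mul]; ring
  · rintro ⟨F, U, hF, hU, hae⟩
    refine ⟨F, U + t • F, hF, ?_, (hU.add (hF.smul t)).isFourierInv⟩
    filter_upwards [hae, Lp.coeFn_add U (t • F), Lp.coeFn_smul t F] with ξ h2 h3 h4
    rw [h3, Pi.add_apply, h4, Pi.smul_apply, h2, smul_eq_mul]; ring

/-- The integral of the resolvent symbol `(|ξ|^α - t)⁻¹` over the coset `c + ℤ_p`. -/
noncomputable def resolventCoeff (α : ℝ) (c : ℚ_[p]) (t : ℝ) : ℝ :=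
  ∫ ξ in Metric.closedBall c 1, (‖ξ‖ ^ α - t)⁻¹ ∂haar p

theorem symbol_pos (α : ℝ) {t : ℝ} (ht : t < 0) (ξ : ℚ_[p]) : 0 < ‖ξ‖ ^ α - t := by
  have : 0 ≤ ‖ξ‖ ^ α := by positivity
  linarith

theorem symbol_ne_zero (α : ℝ) {t : ℝ} (ht : t < 0) (ξ : ℚ_[p]) :
    ((‖ξ‖ ^ α : ℝ) : ℂ) - (t : ℂ) ≠ 0 := by
  exact_mod_cast (symbol_pos α ht ξ).ne'

theorem measurable_symbol_inv (α t : ℝ) :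
    Measurable fun ξ : ℚ_[p] => (‖ξ‖ ^ α - t)⁻¹ := by fun_prop

theorem symbol_inv_le (α : ℝ) {t : ℝ} (ht : t < 0) (ξ : ℚ_[p]) :
    ‖(‖ξ‖ ^ α - t)⁻¹‖ ≤ (-t)⁻¹ := by
  rw [Real.norm_of_nonneg (inv_nonneg.2 (symbol_pos α ht ξ).le)]
  refine inv_anti₀ (by linarith) ?_
  have : 0 ≤ ‖ξ‖ ^ α := by positivity
  linarith

/-- `(|ξ|^α - t)⁻¹` restricted to the coset `c + ℤ_p`. -/
noncomputable def resolventIndicator (α : ℝ) (c : ℚ_[p]) (t : ℝ) (ξ : ℚ_[p]) : ℂ :=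
  (((‖ξ‖ ^ α - t)⁻¹ : ℝ) : ℂ) * cosetIndicator c ξ

theorem memLp_resolventIndicator (α : ℝ) (c : ℚ_[p]) {t : ℝ} (ht : t < 0) :
    MemLp (resolventIndicator α c t) 2 (haar p) := by
  have h := (isTest_cosetIndicator c).memLp (2 : ℝ≥0∞)
  refine MemLp.of_le_mul (c := (-t)⁻¹) h ?_ (Filter.Eventually.of_forall fun ξ => ?_)
  · exact (Complex.measurable_ofReal.comp (measurable_symbol_inv α t)).aestronglyMeasurable.mul h.1
  · rw [resolventIndicator, norm_mul]
    gcongr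
    rw [Complex.norm_real]
    exact symbol_inv_le α ht ξ

theorem integral_resolventIndicator (α : ℝ) (c : ℚ_[p]) (t : ℝ) :
    ∫ ξ, resolventIndicator α c t ξ ∂haar p = resolventCoeff α c t := by
  rw [resolventCoeff, ← integral_indicator measurableSet_closedBall, ← integral_complex_ofReal]
  refine integral_congr_ae (Filter.Eventually.of_forall fun ξ => ?_)
  dsimp only [resolventIndicator]
  by_cases hξ : ξ ∈ Metric.closedBall c 1
  · rw [cosetIndicator_of_mem hξ, Set.indicator_of_mem hξ, mul_one]
  · rw [cosetIndicator_of_notMem hξ, Set.indicator_of_notMem hξ, mul_zero]; simp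

/-- On the coset U is the constant σ times the coefficient, and t < 0 allows division by the symbol:
the coefficient alone determines F there. -/
theorem ae_eq_of_mem_eigenspace {α σ t : ℝ} (ht : t < 0) {f F U : L2 p}
    (hU : IsFourier (potentialOp p σ f) U)
    (hae : ∀ᵐ ξ ∂haar p, U ξ = (((‖ξ‖ ^ α : ℝ) : ℂ) - t) * F ξ) (c : ℚ_[p]) :
    ∀ᵐ ξ ∂haar p, F ξ * cosetIndicator c ξ =
      σ * cosetCoeff c f * resolventIndicator α c t ξ := by
  filter_upwards [hae, ae_eq_of_isFourier_potentialOp hU c] with ξ h1 h2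
  rw [resolventIndicator]
  by_cases hξ : ξ ∈ Metric.closedBall c 1
  · rw [cosetIndicator_of_mem hξ, ← h2 hξ, h1]
    have := symbol_ne_zero α ht ξ
    push_cast
    field_simp
  · rw [cosetIndicator_of_notMem hξ]; ring

/-- Integrating the formula for F over the coset leaves a scalar equation: the coefficient vanishes
unless the secular equation σ · `resolventCoeff` = 1 holds. -/
theorem cosetCoeff_of_mem_eigenspace {α σ t : ℝ} (ht : t < 0) {f : L2 p}
    (hf : f ∈ eigenspace (schrodinger p α σ) (t : ℂ)) (c : ℚ_[p]) :
    cosetCoeff c f = σ * resolventCoeff α c t * cosetCoeff c f := by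
  obtain ⟨F, U, hF, hU, hae⟩ := (mem_eigenspace_schrodinger α σ t f).1 hf
  conv_lhs => rw [hF.cosetCoeff_eq, integral_congr_ae (ae_eq_of_mem_eigenspace ht hU hae c),
    integral_const_mul, integral_resolventIndicator]
  ring

theorem eq_zero_of_cosetCoeff_eq_zero {α σ t : ℝ} (ht : t < 0) {f : L2 p}
    (hf : f ∈ eigenspace (schrodinger p α σ) (t : ℂ)) {ι : Type} [Countable ι] (c : ι → ℚ_[p])
    (hc : ∀ ξ, ∃ i, ξ ∈ Metric.closedBall (c i) 1) (h : ∀ i, cosetCoeff (c i) f = 0) : f = 0 := by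
  obtain ⟨F, U, hF, hU, hae⟩ := (mem_eigenspace_schrodinger α σ t f).1 hf
  have hF0 : F = 0 := by
    refine Lp.ext ?_
    filter_upwards [ae_all_iff.2 fun i => ae_eq_of_mem_eigenspace ht hU hae (c i),
      Lp.coeFn_zero ℂ 2 (haar p)] with ξ h1 h2
    obtain ⟨i, hi⟩ := hc ξ
    have := h1 i
    rw [cosetIndicator_of_mem hi, h i] at this
    rw [h2]
    simpa using this
  refine hF.isFourierInv.unique fun φ hφ => ?_
  rw [hF0, integral_zero_mul, integral_zero_mul]

/-- The eigenfunction is the inverse transform of the resolvent symbol cut to the coset; the secular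
equation says exactly that V f then transforms to the indicator of the coset. -/
theorem exists_mem_eigenspace {α σ t : ℝ} (ht : t < 0) (c : ℚ_[p])
    (h : σ * resolventCoeff α c t = 1) :
    ∃ f ∈ eigenspace (schrodinger p α σ) (t : ℂ), cosetCoeff c f = resolventCoeff α c t ∧
      ∀ c', Disjoint (Metric.closedBall c 1) (Metric.closedBall c' 1) → cosetCoeff c' f = 0 := by
  have he := isUnramified_stdChar p
  have hM := memLp_resolventIndicator α c ht
  obtain ⟨f, hf⟩ := exists_isFourierInv (hM.toLp _)
  have hI := isTest_cosetIndicator c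
  refine ⟨f, (mem_eigenspace_schrodinger α σ t f).2
    ⟨_, (hI.memLp 2).toLp _, hf.isFourier, ?_, ?_⟩, ?_, ?_⟩
  · intro φ hφ
    have hψ : IsTest (fun x => (σ : ℂ) * (cosetIndicator 0 x *
        Fourier.fourierIntegral (stdChar p) (haar p) φ x)) := by
      have h1 := (hφ.fourierIntegral he).indicator
        (IsUltrametricDist.isClopen_closedBall (0 : ℚ_[p]) one_ne_zero)
      convert h1.smul (σ : ℂ) using 1
      ext x
      rw [Pi.smul_apply, smul_eq_mul]
      by_cases hx : x ∈ Metric.closedBall (0 : ℚ_[p]) 1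
      · rw [cosetIndicator_of_mem hx, Set.indicator_of_mem hx, one_mul]
      · rw [cosetIndicator_of_notMem hx, Set.indicator_of_notMem hx, zero_mul]
    have hψ0 : ∀ x ∉ Metric.closedBall (0 : ℚ_[p]) 1, (σ : ℂ) * (cosetIndicator 0 x *
        Fourier.fourierIntegral (stdChar p) (haar p) φ x) = 0 := fun x hx => by
      rw [cosetIndicator_of_notMem hx]; ring
    rw [integral_potentialOp_mul, hf _ hψ]
    -- The inverse transform of V times the transform of φ is constant on cosets, so only its value
    -- at c enters.
    set v := Fourier.fourierIntegral (stdChar p)⁻¹ (haar p) (fun x => (σ : ℂ) *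
      (cosetIndicator 0 x * Fourier.fourierIntegral (stdChar p) (haar p) φ x)) c with hv
    have hv1 : v = σ * ∫ x, cosetIndicator c x * φ x ∂haar p := by
      rw [hv, fourierIntegral_apply]
      conv_rhs => rw [← hφ.fourier_inversion he, ← he.inv.integral_fourierIntegral_mul
        hI.integrable (hφ.fourierIntegral he).integrable, ← integral_const_mul]
      refine integral_congr_ae (Filter.Eventually.of_forall fun x => ?_)
      dsimp only
      rw [he.inv.fourierIntegral_cosetIndicator]
      ring
    have hR : ∫ ξ, hM.toLp _ ξ * Fourier.fourierIntegral (stdChar p)⁻¹ (haar p)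
        (fun x => (σ : ℂ) * (cosetIndicator 0 x *
          Fourier.fourierIntegral (stdChar p) (haar p) φ x)) ξ ∂haar p =
        ∫ ξ, resolventIndicator α c t ξ * v ∂haar p := by
      refine integral_congr_ae ?_
      filter_upwards [hM.coeFn_toLp] with ξ hξ
      rw [hξ]
      by_cases hc : ξ ∈ Metric.closedBall c 1
      · rw [he.inv.fourierIntegral_congr_coset hψ0 hc]
      · rw [resolventIndicator, cosetIndicator_of_notMem hc]; ring
    rw [hR, integral_mul_const, integral_resolventIndicator, hv1, ← mul_assoc]
    have h' : (resolventCoeff α c t : ℂ) * σ = 1 := by rw [mul_comm]; exact_mod_cast h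
    rw [h', one_mul]
    refine integral_congr_ae ?_
    filter_upwards [(hI.memLp 2).coeFn_toLp] with ξ hξ
    rw [hξ]
  · filter_upwards [hM.coeFn_toLp, (hI.memLp 2).coeFn_toLp] with ξ h1 h2
    rw [h1, h2, resolventIndicator]
    have := symbol_ne_zero α ht ξ
    push_cast
    field_simp
  · rw [hf.isFourier.cosetCoeff_eq, ← integral_resolventIndicator]
    refine integral_congr_ae ?_
    filter_upwards [hM.coeFn_toLp] with ξ h1
    rw [h1, resolventIndicator]
    by_cases hc : ξ ∈ Metric.closedBall c 1
    · rw [cosetIndicator_of_mem hc]; ring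
    · rw [cosetIndicator_of_notMem hc]; ring
  · intro c' hcc'
    rw [hf.isFourier.cosetCoeff_eq]
    refine integral_eq_zero_of_ae ?_
    filter_upwards [hM.coeFn_toLp] with ξ h1
    rw [h1, resolventIndicator]
    by_cases hc : ξ ∈ Metric.closedBall c 1
    · rw [cosetIndicator_of_notMem (Set.disjoint_left.1 hcc' hc)]; simp
    · rw [cosetIndicator_of_notMem hc]; simp

/-- The coefficients at the cosets solving the secular equation are coordinates on the eigenspace:
all other coefficients vanish, and the eigenfunctions living on single cosets realise every
coordinate vector. -/
theorem rank_eigenspace {α σ t : ℝ} (ht : t < 0) {ι : Type} [Countable ι] (c : ι → ℚ_[p])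
    (hc : ∀ ξ, ∃ i, ξ ∈ Metric.closedBall (c i) 1)
    (hd : Pairwise fun i j => Disjoint (Metric.closedBall (c i) 1) (Metric.closedBall (c j) 1))
    (hfin : {i | σ * resolventCoeff α (c i) t = 1}.Finite) :
    Module.rank ℂ (eigenspace (schrodinger p α σ) (t : ℂ)) =
      Cardinal.mk {i | σ * resolventCoeff α (c i) t = 1} := by
  set S := {i | σ * resolventCoeff α (c i) t = 1} with hS
  have := hfin.fintype
  let T : eigenspace (schrodinger p α σ) (t : ℂ) →ₗ[ℂ] (S → ℂ) :=
    LinearMap.pi fun i => (cosetCoeff (c i)).comp (Submodule.subtype _)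
  have hinj : Function.Injective T := by
    rw [← LinearMap.ker_eq_bot, LinearMap.ker_eq_bot']
    rintro ⟨f, hf⟩ hTf
    refine Subtype.ext (eq_zero_of_cosetCoeff_eq_zero ht hf c hc fun i => ?_)
    by_cases hi : i ∈ S
    · exact congrFun hTf ⟨i, hi⟩
    · have h1 := cosetCoeff_of_mem_eigenspace ht hf (c i)
      have h2 : ((σ * resolventCoeff α (c i) t : ℝ) : ℂ) ≠ 1 := by
        rw [Ne, Complex.ofReal_eq_one]; exact hi
      push_cast at h2
      have h3 : (1 - (σ : ℂ) * resolventCoeff α (c i) t) * cosetCoeff (c i) f = 0 := by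
        linear_combination h1
      exact (mul_eq_zero.1 h3).resolve_left (sub_ne_zero.2 h2.symm)
  have hsurj : Function.Surjective T := by
    intro v
    choose f hf h1 h2 using fun i : S => exists_mem_eigenspace ht (c i) i.2
    -- Each basic eigenfunction has coefficient `resolventCoeff` on its own coset, nonzero by the
    -- secular equation, so dividing by it normalises to 1.
    refine ⟨∑ i : S, (v i * (resolventCoeff α (c i) t : ℂ)⁻¹) • ⟨f i, hf i⟩, ?_⟩
    ext j
    rw [map_sum, Finset.sum_apply, Finset.sum_eq_single j]
    · rw [map_smul]
      change _ * cosetCoeff (c j) (f j) = _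
      have h0 : (resolventCoeff α (c j) t : ℂ) ≠ 0 := by
        intro h0
        have : σ * resolventCoeff α (c j) t = 1 := j.2
        rw [Complex.ofReal_eq_zero.1 h0, mul_zero] at this
        exact zero_ne_one this
      rw [h1, mul_assoc, inv_mul_cancel₀ h0, mul_one]
    · intro i _ hij
      rw [map_smul]
      change _ * cosetCoeff (c j) (f i) = _
      rw [h2 i _ (hd fun h => hij (Subtype.ext h)), mul_zero]
    · simp
  rw [(LinearEquiv.ofBijective T ⟨hinj, hsurj⟩).rank_eq, rank_fun', Cardinal.mk_fintype]

end Eigen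

/-! ### The secular equation -/

section Secular

variable {q r : ℝ}

theorem summable_secular (hq : 0 < q) (hq1 : q < 1) (hr : 0 < r) {t : ℝ} (ht : t < 0) :
    Summable fun j : ℕ => (1 - q) * q ^ j * (r ^ j - t)⁻¹ := by
  refine Summable.of_nonneg_of_le (fun j => ?_) (fun j => ?_)
    (((summable_geometric_of_lt_one hq.le hq1).mul_left (1 - q)).mul_right (-t)⁻¹)
  · have : 0 ≤ r ^ j - t := by have := pow_pos hr j; linarith
    have : 0 ≤ 1 - q := by linarith
    positivity
  · have : 0 ≤ 1 - q := by linarith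
    gcongr
    · linarith
    · have := pow_pos hr j; linarith

theorem strictMonoOn_secular (hq : 0 < q) (hq1 : q < 1) (hr : 0 < r) :
    StrictMonoOn (fun t : ℝ => ∑' j : ℕ, (1 - q) * q ^ j * (r ^ j - t)⁻¹) (Set.Iio 0) := by
  intro s hs t ht hst
  rw [Set.mem_Iio] at hs ht
  have h0 : 0 < 1 - q := by linarith
  have key : ∀ j : ℕ, (1 - q) * q ^ j * (r ^ j - s)⁻¹ < (1 - q) * q ^ j * (r ^ j - t)⁻¹ := by
    intro j
    have h1 : 0 < r ^ j - t := by have := pow_pos hr j; linarith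
    gcongr
  exact (summable_secular hq hq1 hr hs).tsum_lt_tsum (fun j => (key j).le) (key 0)
    (summable_secular hq hq1 hr ht)

theorem continuousOn_secular (hq : 0 < q) (hq1 : q < 1) (hr : 0 < r) :
    ContinuousOn (fun t : ℝ => ∑' j : ℕ, (1 - q) * q ^ j * (r ^ j - t)⁻¹) (Set.Iio 0) := by
  intro t ht
  rw [Set.mem_Iio] at ht
  have h0 : 0 ≤ 1 - q := by linarith
  -- Away from 0 the factors are bounded uniformly by (-(t/2))⁻¹, so the Weierstrass test applies
  -- near t.
  have h : ContinuousOn (fun t : ℝ => ∑' j : ℕ, (1 - q) * q ^ j * (r ^ j - t)⁻¹)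
      (Set.Iio (t / 2)) := by
    refine continuousOn_tsum (u := fun j => (1 - q) * q ^ j * (-(t / 2))⁻¹) (fun j => ?_)
      (((summable_geometric_of_lt_one hq.le hq1).mul_left (1 - q)).mul_right _) (fun j s hs => ?_)
    · refine continuousOn_const.mul (ContinuousOn.inv₀ (by fun_prop) fun s hs => ?_)
      rw [Set.mem_Iio] at hs
      have := pow_pos hr j
      exact ne_of_gt (by linarith)
    · rw [Set.mem_Iio] at hs
      have := pow_pos hr j
      have h1 : 0 < r ^ j - s := by linarith
      rw [Real.norm_of_nonneg (by positivity)]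
      gcongr
      · linarith
      · linarith
  exact (h.continuousAt (Iio_mem_nhds (by linarith))).continuousWithinAt

/-- Serves the convergent and the divergent geometric series at once; in the application x =
p^{α-1}, so both α < 1 and α ≥ 1 are covered. -/
theorem exists_geom_sum_gt {x s : ℝ} (hx : 0 < x) (hs : 0 < s) (h : 1 - x < s) :
    ∃ N : ℕ, 1 < s * ∑ j ∈ Finset.range N, x ^ j := by
  rcases lt_or_ge x 1 with hx1 | hx1
  · have h1 := (hasSum_geometric_of_lt_one hx.le hx1).tendsto_sum_nat.const_mul s
    have h2 : 1 < s * (1 - x)⁻¹ := by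
      rw [← div_eq_mul_inv, one_lt_div (by linarith)]; exact h
    exact (h1.eventually (lt_mem_nhds h2)).exists
  · obtain ⟨N, hN⟩ := exists_nat_gt s⁻¹
    refine ⟨N, ?_⟩
    have h1 : (N : ℝ) ≤ ∑ j ∈ Finset.range N, x ^ j := by
      calc (N : ℝ) = ∑ j ∈ Finset.range N, (1 : ℝ) := by simp
        _ ≤ _ := Finset.sum_le_sum fun j _ => one_le_pow₀ hx1
    calc 1 = s * s⁻¹ := (mul_inv_cancel₀ hs.ne').symm
      _ < s * ∑ j ∈ Finset.range N, x ^ j := by gcongr; linarith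

/-- At t = 0 the series becomes geometric with ratio q/r. Every term is strictly smaller for t < 0,
so σ⁻¹ must be below that sum; conversely the intermediate value theorem produces a solution. -/
theorem exists_secular_eq_iff (hq : 0 < q) (hq1 : q < 1) (hr : 0 < r) {σ : ℝ} (hσ : 0 < σ) :
    (∃ t < 0, σ * ∑' j : ℕ, (1 - q) * q ^ j * (r ^ j - t)⁻¹ = 1) ↔ 1 - q / r < σ * (1 - q) := by
  have h0 : 0 < 1 - q := by linarith
  have hx : 0 < q / r := by positivity
  have hterm : ∀ j : ℕ, (1 - q) * q ^ j * (r ^ j)⁻¹ = (1 - q) * (q / r) ^ j := fun j => by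
    rw [div_pow, mul_assoc, div_eq_mul_inv]
  constructor
  · rintro ⟨t, ht, h⟩
    by_contra! hle
    have hx1 : q / r < 1 := by linarith [mul_pos hσ h0]
    have key : ∀ j : ℕ, (1 - q) * q ^ j * (r ^ j - t)⁻¹ < (1 - q) * (q / r) ^ j := by
      intro j
      have := pow_pos hr j
      rw [← hterm]
      gcongr
      linarith
    have h1 := (summable_secular hq hq1 hr ht).tsum_lt_tsum (fun j => (key j).le) (key 0)
      ((summable_geometric_of_lt_one hx.le hx1).mul_left _)
    rw [tsum_mul_left, tsum_geometric_of_lt_one hx.le hx1] at h1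
    have h2 : 1 < σ * ((1 - q) * (1 - q / r)⁻¹) := by
      exact h.symm.trans_lt (mul_lt_mul_of_pos_left h1 hσ)
    rw [← mul_assoc, ← div_eq_mul_inv, one_lt_div (by linarith)] at h2
    linarith
  · intro h
    -- A finite partial sum already exceeds σ⁻¹ at t = 0 and is continuous there, while the series
    -- itself may diverge at 0.
    obtain ⟨N, hN⟩ := exists_geom_sum_gt hx (by positivity) h
    set g := fun t : ℝ => ∑' j : ℕ, (1 - q) * q ^ j * (r ^ j - t)⁻¹ with hg
    have hc : ContinuousAt (fun t : ℝ => σ * ∑ j ∈ Finset.range N,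
        (1 - q) * q ^ j * (r ^ j - t)⁻¹) 0 := by
      refine continuousAt_const.mul (tendsto_finsetSum _ fun j _ => ?_)
      refine continuousAt_const.mul (ContinuousAt.inv₀ (by fun_prop) ?_)
      rw [sub_zero]; positivity
    have hval : 1 < σ * ∑ j ∈ Finset.range N, (1 - q) * q ^ j * (r ^ j - 0)⁻¹ := by
      simp only [sub_zero, hterm]
      rw [← Finset.mul_sum, ← mul_assoc]
      exact hN
    have hev := (hc.eventually (lt_mem_nhds hval)).filter_mono
      (nhdsWithin_le_nhds (s := Set.Iio (0 : ℝ)))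
    obtain ⟨t₁, h1, ht₁⟩ := (hev.and self_mem_nhdsWithin).exists
    have hg1 : σ⁻¹ ≤ g t₁ := by
      rw [inv_le_iff_one_le_mul₀' hσ]
      refine h1.le.trans ?_
      gcongr
      refine (summable_secular hq hq1 hr ht₁).sum_le_tsum _ fun j _ => ?_
      have := pow_pos hr j
      have : 0 ≤ r ^ j - t₁ := by linarith
      positivity
    -- At t = -σ each factor is at most σ⁻¹, and the weights (1 - q) q^j sum to 1.
    have hg0 : g (-σ) ≤ σ⁻¹ := by
      have hs : HasSum (fun j : ℕ => (1 - q) * q ^ j * σ⁻¹) σ⁻¹ := by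
        have := ((hasSum_geometric_of_lt_one hq.le hq1).mul_left (1 - q)).mul_right σ⁻¹
        rwa [mul_inv_cancel₀ h0.ne', one_mul] at this
      rw [← hs.tsum_eq]
      refine (summable_secular hq hq1 hr (by linarith)).tsum_le_tsum (fun j => ?_) hs.summable
      have := pow_pos hr j
      gcongr
      linarith
    obtain ⟨t, ht, hgt⟩ := isPreconnected_Iio.intermediate_value
      (Set.mem_Iio.2 (neg_lt_zero.2 hσ)) (Set.mem_Iio.2 ht₁)
      (continuousOn_secular hq hq1 hr) ⟨hg0, hg1⟩
    refine ⟨t, ht, ?_⟩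
    dsimp only at hgt
    rw [hgt]
    exact mul_inv_cancel₀ hσ.ne'

end Secular

/-! ### The secular function of each coset -/

section Resolvent

variable {p : ℕ} [Fact p.Prime]

theorem norm_eq_of_mem_closedBall {c ξ : ℚ_[p]} (hc : 1 < ‖c‖) (h : ξ ∈ Metric.closedBall c 1) :
    ‖ξ‖ = ‖c‖ := by
  rw [Metric.mem_closedBall, dist_eq_norm] at h
  exact Padic.norm_eq_of_norm_sub_lt_right (h.trans_lt hc)

theorem resolventCoeff_of_one_lt (α : ℝ) {c : ℚ_[p]} (hc : 1 < ‖c‖) (t : ℝ) :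
    resolventCoeff α c t = (‖c‖ ^ α - t)⁻¹ := by
  rw [resolventCoeff, setIntegral_congr_fun measurableSet_closedBall
    (g := fun _ => (‖c‖ ^ α - t)⁻¹) fun ξ hξ => by
      simp only [norm_eq_of_mem_closedBall hc hξ]]
  rw [setIntegral_const, haar_real_closedBall_one, one_smul]

/-- Up to the null set {0}, ℤ_p is the disjoint union of the spheres |ξ| = p^{-j}, of measure (1 -
p⁻¹) p^{-j}, on which the integrand is constant. -/
theorem resolventCoeff_zero (α : ℝ) {t : ℝ} (ht : t < 0) :
    resolventCoeff (p := p) α 0 t =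
      ∑' j : ℕ, (1 - (p : ℝ)⁻¹) * (p : ℝ)⁻¹ ^ j * (((p : ℝ)⁻¹ ^ α) ^ j - t)⁻¹ := by
  have hp := one_lt_prime_real p
  set S : ℕ → Set ℚ_[p] := fun j => Metric.closedBall 0 ((p : ℝ) ^ (-(j : ℤ))) \
    Metric.closedBall 0 ((p : ℝ) ^ (-(j : ℤ) - 1)) with hS
  have hSn : ∀ j, ∀ ξ ∈ S j, ‖ξ‖ = (p : ℝ) ^ (-(j : ℤ)) := by
    rintro j ξ ⟨h1, h2⟩
    rw [mem_closedBall_zero_iff] at h1 h2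
    refine le_antisymm h1 ?_
    rw [← norm_lt_zpow_add_one_iff, sub_add_cancel] at h2
    exact not_lt.1 h2
  have hSm : ∀ j, MeasurableSet (S j) := fun j =>
    measurableSet_closedBall.diff measurableSet_closedBall
  have hSd : Pairwise (Function.onFun Disjoint S) := by
    intro i j hij
    refine Set.disjoint_left.2 fun ξ hi hj => hij ?_
    have := (hSn i ξ hi).symm.trans (hSn j ξ hj)
    have := zpow_right_injective₀ (by linarith) hp.ne' this
    lia
  have hSv : ∀ j, (haar p).real (S j) = (1 - (p : ℝ)⁻¹) * (p : ℝ)⁻¹ ^ j := by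
    intro j
    rw [hS, measureReal_sdiff (Metric.closedBall_subset_closedBall
      (zpow_le_zpow_right₀ hp.le (by lia))) measurableSet_closedBall
      (measure_closedBall_lt_top).ne]
    rw [haar_real_closedBall_zpow, haar_real_closedBall_zpow, zpow_sub₀ (by positivity), zpow_neg,
      zpow_natCast, inv_pow, zpow_one]
    ring
  have hU : (⋃ j, S j) =ᵐ[haar p] Metric.closedBall (0 : ℚ_[p]) 1 := by
    have hU' : (⋃ j, S j) = Metric.closedBall (0 : ℚ_[p]) 1 \ {0} := by
      ext ξ
      simp only [Set.mem_iUnion, Set.mem_sdiff, Set.mem_singleton_iff, mem_closedBall_zero_iff]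
      constructor
      · rintro ⟨j, hj⟩
        have := hSn j ξ hj
        refine ⟨this ▸ zpow_le_one_of_nonpos₀ hp.le (by lia), ?_⟩
        rintro rfl
        rw [norm_zero] at this
        exact (zpow_pos (by linarith) _).ne this
      · rintro ⟨h1, h0⟩
        have hv := Padic.norm_eq_zpow_neg_valuation h0
        have hv0 := (Padic.norm_le_one_iff_val_nonneg ξ).1 h1
        refine ⟨ξ.valuation.toNat, ?_, ?_⟩
        · rw [mem_closedBall_zero_iff, hv, Int.toNat_of_nonneg hv0]
        · rw [mem_closedBall_zero_iff, ← norm_lt_zpow_add_one_iff, hv, Int.toNat_of_nonneg hv0,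
            sub_add_cancel]
          exact lt_irrefl _
    rw [hU']
    exact sdiff_null_ae_eq_self (measure_singleton 0)
  have hint : IntegrableOn (fun ξ : ℚ_[p] => (‖ξ‖ ^ α - t)⁻¹) (⋃ j, S j) (haar p) := by
    refine IntegrableOn.congr_set_ae ?_ hU
    refine Measure.integrableOn_of_bounded (M := (-t)⁻¹) measure_closedBall_lt_top.ne
      (measurable_symbol_inv α t).aestronglyMeasurable
      (Filter.Eventually.of_forall fun ξ => symbol_inv_le α ht ξ)
  rw [resolventCoeff, ← setIntegral_congr_set hU, ← (hasSum_integral_iUnion hSm hSd hint).tsum_eq]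
  congr 1
  ext j
  rw [setIntegral_congr_fun (hSm j) (g := fun _ => (((p : ℝ)⁻¹ ^ α) ^ j - t)⁻¹) fun ξ hξ => ?_]
  · rw [setIntegral_const, hSv, smul_eq_mul]
  · dsimp only
    rw [hSn j ξ hξ, zpow_neg, zpow_natCast, ← inv_pow, ← Real.rpow_natCast, ← Real.rpow_natCast,
      ← Real.rpow_mul (by positivity), ← Real.rpow_mul (by positivity), mul_comm]

theorem exists_resolventCoeff_zero_iff (α : ℝ) {σ : ℝ} (hσ : 0 < σ) :
    (∃ t < 0, σ * resolventCoeff (p := p) α 0 t = 1) ↔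
      ((p : ℝ) - (p : ℝ) ^ α) / ((p : ℝ) - 1) < σ := by
  have hp := one_lt_prime_real p
  have hp0 : (0 : ℝ) < p := by linarith
  have h1 := exists_secular_eq_iff (q := (p : ℝ)⁻¹) (r := (p : ℝ)⁻¹ ^ α) (by positivity)
    (inv_lt_one_of_one_lt₀ hp) (by positivity) hσ
  have h2 : (∃ t < 0, σ * resolventCoeff (p := p) α 0 t = 1) ↔
      ∃ t < 0, σ * ∑' j : ℕ, (1 - (p : ℝ)⁻¹) * (p : ℝ)⁻¹ ^ j *
        (((p : ℝ)⁻¹ ^ α) ^ j - t)⁻¹ = 1 :=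
    exists_congr fun t => and_congr_right fun ht => by rw [resolventCoeff_zero α ht]
  rw [h2, h1, div_lt_iff₀ (by linarith), ← mul_lt_mul_iff_left₀ hp0, Real.inv_rpow hp0.le]
  have e1 : (1 - (p : ℝ)⁻¹ / ((p : ℝ) ^ α)⁻¹) * p = p - (p : ℝ) ^ α := by
    field_simp
  have e2 : σ * (1 - (p : ℝ)⁻¹) * p = σ * (p - 1) := by field_simp
  rw [e1, e2]

theorem resolventCoeff_zero_injOn (α : ℝ) :
    Set.InjOn (resolventCoeff (p := p) α 0) (Set.Iio 0) := by
  have hp := one_lt_prime_real p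
  intro s hs t ht h
  rw [resolventCoeff_zero α hs, resolventCoeff_zero α ht] at h
  exact (strictMonoOn_secular (q := (p : ℝ)⁻¹) (r := (p : ℝ)⁻¹ ^ α) (by positivity)
    (inv_lt_one_of_one_lt₀ hp) (by positivity)).injOn hs ht h

end Resolvent

/-! ### Representatives of `ℚ_p / ℤ_p` -/

/-- The elements of `ℤ[1/p] ∩ [0, 1)`, which represent the cosets of `ℤ_p` in `ℚ_p`. -/
abbrev CosetRep (p : ℕ) : Type := {q : ℚ // ∃ a n : ℕ, a < p ^ n ∧ q = a / (p : ℚ) ^ n}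

instance instZeroCosetRep (p : ℕ) : Zero (CosetRep p) := ⟨⟨0, 0, 0, by simp, by simp⟩⟩

section CosetRep

theorem CosetRep.coe_zero {p : ℕ} : ((0 : CosetRep p) : ℚ) = 0 := rfl

theorem CosetRep.nonneg {p : ℕ} (c : CosetRep p) : 0 ≤ (c : ℚ) := by
  obtain ⟨_, a, n, _, rfl⟩ := c
  positivity

variable {p : ℕ} [Fact p.Prime]

theorem CosetRep.exists_mem_closedBall (ξ : ℚ_[p]) :
    ∃ c : CosetRep p, ξ ∈ Metric.closedBall ((c : ℚ) : ℚ_[p]) 1 := by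
  refine ⟨⟨fracPart p ξ, _, _, PadicInt.appr_lt _ _, rfl⟩, ?_⟩
  rw [Metric.mem_closedBall, dist_eq_norm]
  exact norm_sub_fracPart_le p ξ

theorem CosetRep.lt_one (c : CosetRep p) : (c : ℚ) < 1 := by
  obtain ⟨_, a, n, h, rfl⟩ := c
  have : 0 < p := (Fact.out : p.Prime).pos
  dsimp only
  rw [div_lt_one (by positivity)]
  exact_mod_cast h

/-- The difference has a power of p as denominator and lies in ℤ_p, hence is an integer; it is
strictly between -1 and 1. -/
theorem CosetRep.eq_of_norm_sub_le_one {c c' : CosetRep p}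
    (h : ‖((c : ℚ) : ℚ_[p]) - ((c' : ℚ) : ℚ_[p])‖ ≤ 1) : c = c' := by
  have hp : (p : ℚ) ≠ 0 := by exact_mod_cast (Fact.out : p.Prime).ne_zero
  have h0 := c.nonneg
  have h1 := c.lt_one
  have h0' := c'.nonneg
  have h1' := c'.lt_one
  obtain ⟨a, m, -, ha⟩ := c.2
  obtain ⟨b, n, -, hb⟩ := c'.2
  have e : (c : ℚ) - c' = ((a * (p : ℤ) ^ n - b * (p : ℤ) ^ m : ℤ) : ℚ) / (p : ℚ) ^ (m + n) := by
    rw [ha, hb, pow_add]; push_cast; field_simp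
  rw [← Rat.cast_sub, e] at h
  obtain ⟨k, hk⟩ := exists_int_of_norm_le_one p _ _ h
  rw [← e] at hk
  have hk1 : (k : ℚ) < 1 := by linarith
  have hk2 : (-1 : ℚ) < k := by linarith
  have hk0 : k = 0 := by
    have : k < 1 := by exact_mod_cast hk1
    have : -1 < k := by exact_mod_cast hk2
    lia
  rw [hk0, Int.cast_zero, sub_eq_zero] at hk
  exact Subtype.ext hk

theorem CosetRep.pairwise_disjoint : Pairwise fun c c' : CosetRep p =>
    Disjoint (Metric.closedBall ((c : ℚ) : ℚ_[p]) 1) (Metric.closedBall ((c' : ℚ) : ℚ_[p]) 1) := by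
  intro c c' hcc'
  refine Set.disjoint_left.2 fun x h h' => hcc' (CosetRep.eq_of_norm_sub_le_one ?_)
  rw [← dist_eq_norm]
  rw [Metric.mem_closedBall] at h h'
  exact (dist_triangle_max _ x _).trans (max_le (dist_comm x _ ▸ h) h')

theorem CosetRep.one_lt_norm {c : CosetRep p} (hc : c ≠ 0) : 1 < ‖((c : ℚ) : ℚ_[p])‖ := by
  by_contra! h
  exact hc (CosetRep.eq_of_norm_sub_le_one (by simpa [CosetRep.coe_zero] using h))

/-- The norm bound makes p^n c an integer, so these representatives are exactly a/p^n with 0 ≤ a <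
p^n, including 0. -/
theorem CosetRep.mk_norm_le (n : ℕ) :
    Cardinal.mk {c : CosetRep p | ‖((c : ℚ) : ℚ_[p])‖ ≤ (p : ℝ) ^ n} = (p ^ n : ℕ) := by
  have hp : 0 < p := (Fact.out : p.Prime).pos
  have hp0 : (p : ℚ) ≠ 0 := by exact_mod_cast hp.ne'
  have hpr : (0 : ℝ) < p := by exact_mod_cast hp
  rw [← Cardinal.mk_fin]
  refine (Cardinal.mk_congr (Equiv.ofBijective (fun a : Fin (p ^ n) =>
    (⟨⟨(a : ℕ) / (p : ℚ) ^ n, a, n, a.2, rfl⟩, ?_⟩ :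
      {c : CosetRep p | ‖((c : ℚ) : ℚ_[p])‖ ≤ (p : ℝ) ^ n})) ⟨?_, ?_⟩)).symm
  · rw [Set.mem_ofPred_eq]
    push_cast
    rw [norm_div, Padic.norm_p_pow, zpow_neg, zpow_natCast, div_inv_eq_mul]
    have := Padic.norm_int_le_one (p := p) (a : ℕ)
    rw [Int.cast_natCast] at this
    exact mul_le_of_le_one_left (by positivity) this
  · intro a b hab
    have h : ((a : ℕ) : ℚ) / (p : ℚ) ^ n = (b : ℕ) / (p : ℚ) ^ n :=
      congrArg (fun x : {c : CosetRep p | ‖((c : ℚ) : ℚ_[p])‖ ≤ (p : ℝ) ^ n} => (x.1 : ℚ)) hab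
    rw [div_left_inj' (pow_ne_zero n hp0)] at h
    exact Fin.ext (by exact_mod_cast h)
  · rintro ⟨c, hc⟩
    have h0 := c.nonneg
    have h1 := c.lt_one
    obtain ⟨a, m, -, ha⟩ := c.2
    rw [Set.mem_ofPred_eq] at hc
    have e : ((a * (p : ℤ) ^ n : ℤ) : ℚ) / (p : ℚ) ^ m = (c : ℚ) * (p : ℚ) ^ n := by
      rw [ha]; push_cast; ring
    obtain ⟨k, hk⟩ := exists_int_of_norm_le_one p (a * (p : ℤ) ^ n) m (by
      rw [e]
      push_cast
      rw [norm_mul, Padic.norm_p_pow, zpow_neg, zpow_natCast, ← div_eq_mul_inv,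
        div_le_one (by positivity)]
      exact hc)
    rw [e] at hk
    have hpn : (0 : ℚ) < (p : ℚ) ^ n := by positivity
    have hk0 : 0 ≤ k := by
      have : (0 : ℚ) ≤ k := hk ▸ by positivity
      exact_mod_cast this
    lift k to ℕ using hk0
    rw [Int.cast_natCast] at hk
    have hkn : k < p ^ n := by
      have : (k : ℚ) < (p : ℚ) ^ n := by rw [← hk]; exact mul_lt_of_lt_one_left hpn h1
      exact_mod_cast this
    refine ⟨⟨k, hkn⟩, Subtype.ext (Subtype.ext ?_)⟩
    dsimp only
    rw [← hk, mul_div_cancel_right₀ _ hpn.ne']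

end CosetRep

/-! ### Counting the negative eigenvalues -/

section Count

variable {p : ℕ} [Fact p.Prime]

theorem secular_iff_of_ne_zero (α σ : ℝ) {t : ℝ} (ht : t < 0) {c : CosetRep p} (hc : c ≠ 0) :
    σ * resolventCoeff α ((c : ℚ) : ℚ_[p]) t = 1 ↔ t = ‖((c : ℚ) : ℚ_[p])‖ ^ α - σ := by
  rw [resolventCoeff_of_one_lt α (CosetRep.one_lt_norm hc), mul_inv_eq_one₀
    (symbol_pos α ht _).ne']
  constructor <;> intro h <;> linarith

/-- A nonzero solution has |c|^α = σ + t < σ, which bounds |c|. -/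
theorem finite_secular {α σ : ℝ} (hα : 0 < α) {t : ℝ} (ht : t < 0) :
    {c : CosetRep p | σ * resolventCoeff α ((c : ℚ) : ℚ_[p]) t = 1}.Finite := by
  have hp := one_lt_prime_real p
  obtain ⟨n, hn⟩ := pow_unbounded_of_one_lt σ (Real.one_lt_rpow hp hα)
  have hfin : {c : CosetRep p | ‖((c : ℚ) : ℚ_[p])‖ ≤ (p : ℝ) ^ n}.Finite := by
    rw [← Cardinal.lt_aleph0_iff_set_finite, CosetRep.mk_norm_le]
    exact Cardinal.natCast_lt_aleph0
  refine hfin.subset fun c hc => ?_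
  rw [Set.mem_ofPred_eq] at hc ⊢
  by_cases h0 : c = 0
  · rw [h0, CosetRep.coe_zero, Rat.cast_zero, norm_zero]
    positivity
  · rw [secular_iff_of_ne_zero α σ ht h0] at hc
    rw [← Real.rpow_le_rpow_iff (norm_nonneg _) (by positivity) hα]
    have : ((p : ℝ) ^ n) ^ α = ((p : ℝ) ^ α) ^ n := by
      rw [← Real.rpow_natCast, ← Real.rpow_natCast, ← Real.rpow_mul (by positivity),
        ← Real.rpow_mul (by positivity), mul_comm]
    rw [this]
    linarith

/-- Eigenvalues with multiplicity correspond to pairs (t, c) solving the secular equation. Each c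
admits at most one t, so projecting to c loses nothing. -/
theorem negCount_schrodinger {α σ : ℝ} (hα : 0 < α) (hσ : 0 < σ) :
    negCount (schrodinger p α σ) = Cardinal.mk
      {c : CosetRep p | ∃ t < 0, σ * resolventCoeff α ((c : ℚ) : ℚ_[p]) t = 1} := by
  have h1 : ∀ t : Set.Iio (0 : ℝ), Module.rank ℂ (eigenspace (schrodinger p α σ) ((t : ℝ) : ℂ)) =
      Cardinal.mk {c : CosetRep p | σ * resolventCoeff α ((c : ℚ) : ℚ_[p]) t = 1} := fun t =>
    rank_eigenspace t.2 (fun c : CosetRep p => ((c : ℚ) : ℚ_[p])) CosetRep.exists_mem_closedBall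
      CosetRep.pairwise_disjoint (finite_secular hα t.2)
  rw [negCount, funext h1, ← Cardinal.mk_sigma]
  refine Cardinal.mk_congr (Equiv.ofBijective
    (fun x => ⟨x.2.1, x.1, x.1.2, x.2.2⟩) ⟨?_, ?_⟩)
  · rintro ⟨⟨s, hs⟩, ⟨c, hcs⟩⟩ ⟨⟨t, ht⟩, ⟨c', hct⟩⟩ h
    obtain rfl : c = c' := congrArg Subtype.val h
    rw [Set.mem_ofPred_eq] at hcs hct
    obtain rfl : s = t := by
      by_cases h0 : c = 0
      · subst h0
        rw [CosetRep.coe_zero, Rat.cast_zero] at hcs hct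
        exact resolventCoeff_zero_injOn α hs ht (mul_left_cancel₀ hσ.ne' (hcs.trans hct.symm))
      · exact ((secular_iff_of_ne_zero α σ hs h0).1 hcs).trans
          ((secular_iff_of_ne_zero α σ ht h0).1 hct).symm
    rfl
  · rintro ⟨c, t, ht, hc⟩
    exact ⟨⟨⟨t, ht⟩, ⟨c, hc⟩⟩, rfl⟩

theorem exists_secular_zero_iff (α : ℝ) {σ : ℝ} (hσ : 0 < σ) :
    (∃ t < 0, σ * resolventCoeff α (((0 : CosetRep p) : ℚ) : ℚ_[p]) t = 1) ↔
      ((p : ℝ) - (p : ℝ) ^ α) / ((p : ℝ) - 1) < σ := by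
  rw [CosetRep.coe_zero, Rat.cast_zero]
  exact exists_resolventCoeff_zero_iff α hσ

theorem exists_secular_iff_of_ne_zero (α σ : ℝ) {c : CosetRep p} (hc : c ≠ 0) :
    (∃ t < 0, σ * resolventCoeff α ((c : ℚ) : ℚ_[p]) t = 1) ↔ ‖((c : ℚ) : ℚ_[p])‖ ^ α < σ := by
  constructor
  · rintro ⟨t, ht, h⟩
    rw [secular_iff_of_ne_zero α σ ht hc] at h
    linarith
  · intro h
    have ht : ‖((c : ℚ) : ℚ_[p])‖ ^ α - σ < 0 := by linarith
    exact ⟨_, ht, (secular_iff_of_ne_zero α σ ht hc).2 rfl⟩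

/-- Norms take values in powers of p, so exceeding p^n means reaching p^{n+1}. -/
theorem rpow_le_of_one_lt_norm {α : ℝ} (hα : 0 < α) {n : ℕ} {x : ℚ_[p]} (hx : (p : ℝ) ^ n < ‖x‖) :
    ((p : ℝ) ^ α) ^ (n + 1) ≤ ‖x‖ ^ α := by
  have h : (p : ℝ) ^ (n + 1) ≤ ‖x‖ := by
    have := norm_lt_zpow_add_one_iff x (n : ℤ)
    rw [zpow_natCast] at this
    have h2 := mt this.1 (not_le.2 hx)
    rw [not_lt] at h2
    exact_mod_cast h2
  calc ((p : ℝ) ^ α) ^ (n + 1) = ((p : ℝ) ^ (n + 1)) ^ α := (Real.rpow_pow_comm (by positivity) _ _)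
    _ ≤ ‖x‖ ^ α := by gcongr

theorem integral_potential_rpow {α σ : ℝ} (hα : 0 < α) :
    ∫ x, potential p σ x ^ (1 / α) ∂haar p = σ ^ (1 / α) := by
  have h : (fun x => potential p σ x ^ (1 / α)) =
      (integerBall p).indicator fun _ => σ ^ (1 / α) := by
    ext x
    by_cases hx : x ∈ integerBall p
    · simp [potential, hx]
    · simp [potential, hx, Real.zero_rpow (inv_ne_zero hα.ne')]
  rw [h, integral_indicator (measurableSet_integerBall p), setIntegral_const, measureReal_def,
    haar_integerBall]
  simp

/-! ### Counts in the three regimes of σ -/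

theorem critical_lt_one {α : ℝ} (hα : 0 < α) :
    ((p : ℝ) - (p : ℝ) ^ α) / ((p : ℝ) - 1) < 1 := by
  have hp := one_lt_prime_real p
  rw [div_lt_one (by linarith)]
  linarith [Real.one_lt_rpow hp hα]

theorem le_rpow_norm_of_ne_zero {α : ℝ} (hα : 0 < α) {c : CosetRep p} (hc : c ≠ 0) :
    (p : ℝ) ^ α ≤ ‖((c : ℚ) : ℚ_[p])‖ ^ α := by
  have h : (p : ℝ) ^ 0 < ‖((c : ℚ) : ℚ_[p])‖ := by
    rw [pow_zero]; exact CosetRep.one_lt_norm hc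
  have := rpow_le_of_one_lt_norm hα h
  rwa [zero_add, pow_one] at this

theorem negCount_of_le_critical {α σ : ℝ} (hα : 0 < α) (hσ : 0 < σ)
    (h : σ ≤ ((p : ℝ) - (p : ℝ) ^ α) / ((p : ℝ) - 1)) : negCount (schrodinger p α σ) = 0 := by
  rw [negCount_schrodinger hα hσ, Cardinal.mk_eq_zero_iff]
  refine ⟨fun ⟨c, hc⟩ => ?_⟩
  rw [Set.mem_ofPred_eq] at hc
  by_cases h0 : c = 0
  · rw [h0, exists_secular_zero_iff α hσ] at hc
    linarith
  · rw [exists_secular_iff_of_ne_zero α σ h0] at hc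
    linarith [le_rpow_norm_of_ne_zero hα h0, critical_lt_one (p := p) hα,
      Real.one_lt_rpow (one_lt_prime_real p) hα]

theorem negCount_of_critical_lt_of_le {α σ : ℝ} (hα : 0 < α) (hσ : 0 < σ)
    (h : ((p : ℝ) - (p : ℝ) ^ α) / ((p : ℝ) - 1) < σ) (h' : σ ≤ (p : ℝ) ^ α) :
    negCount (schrodinger p α σ) = 1 := by
  have hS : {c : CosetRep p | ∃ t < 0, σ * resolventCoeff α ((c : ℚ) : ℚ_[p]) t = 1} = {0} := by
    ext c
    rw [Set.mem_ofPred_eq, Set.mem_singleton_iff]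
    by_cases h0 : c = 0
    · rw [h0, exists_secular_zero_iff α hσ]
      simpa using h
    · rw [exists_secular_iff_of_ne_zero α σ h0]
      exact iff_of_false (by linarith [le_rpow_norm_of_ne_zero hα h0]) h0
  rw [negCount_schrodinger hα hσ, hS, Cardinal.mk_singleton]

/-- Since n ≥ 0, σ exceeds 1 and ℤ_p always contributes. A nonzero c contributes iff |c|^α < σ, that
is |c| ≤ p^n, because the next possible norm p^{n+1} is already too large. -/
theorem negCount_of_pow_lt {α σ : ℝ} (hα : 0 < α) {n : ℕ} (h : ((p : ℝ) ^ α) ^ n < σ)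
    (h' : σ ≤ ((p : ℝ) ^ α) ^ (n + 1)) : negCount (schrodinger p α σ) = (p ^ n : ℕ) := by
  have hp := one_lt_prime_real p
  have hone : 1 ≤ ((p : ℝ) ^ α) ^ n := one_le_pow₀ (Real.one_lt_rpow hp hα).le
  have hσ : 0 < σ := by linarith
  rw [negCount_schrodinger hα hσ, ← CosetRep.mk_norm_le n]
  congr 2
  ext c
  rw [Set.mem_ofPred_eq, Set.mem_ofPred_eq]
  by_cases h0 : c = 0
  · subst h0
    refine iff_of_true ((exists_secular_zero_iff α hσ).2 ?_) ?_
    · linarith [critical_lt_one (p := p) hα]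
    · rw [CosetRep.coe_zero, Rat.cast_zero, norm_zero]
      positivity
  · rw [exists_secular_iff_of_ne_zero α σ h0]
    constructor
    · intro hc
      by_contra! hlt
      linarith [rpow_le_of_one_lt_norm hα hlt]
    · intro hc
      calc ‖((c : ℚ) : ℚ_[p])‖ ^ α ≤ ((p : ℝ) ^ n) ^ α := by gcongr
        _ = ((p : ℝ) ^ α) ^ n := (Real.rpow_pow_comm (by positivity) _ _).symm
        _ < σ := h

theorem exists_negCount_eq {α σ : ℝ} (hα : 0 < α) (h : (p : ℝ) ^ α < σ) :
    ∃ N : ℕ, negCount (schrodinger p α σ) = (N : Cardinal) ∧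
      (N : ℝ) < σ ^ (1 / α) ∧ σ ^ (1 / α) ≤ p * N := by
  have hp := one_lt_prime_real p
  have hpα := Real.one_lt_rpow hp hα
  -- The interval is open on the left and closed on the right because a coset counts only if |c|^α <
  -- σ strictly.
  obtain ⟨n, hn, hn'⟩ := exists_mem_Ioc_zpow (x := σ) (by linarith) hpα
  have hn0 : 0 ≤ n := by
    have : (p : ℝ) ^ α < ((p : ℝ) ^ α) ^ (n + 1) := h.trans_le hn'
    rw [← zpow_one ((p : ℝ) ^ α), ← zpow_mul, one_mul, zpow_lt_zpow_iff_right₀ hpα] at this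
    lia
  lift n to ℕ using hn0
  rw [zpow_natCast] at hn
  have hn2 : σ ≤ ((p : ℝ) ^ α) ^ (n + 1) := by exact_mod_cast hn'
  have hroot : ∀ k : ℕ, (((p : ℝ) ^ α) ^ k) ^ (1 / α) = (p : ℝ) ^ k := fun k => by
    rw [Real.rpow_pow_comm (by positivity), ← Real.rpow_mul (by positivity), mul_one_div,
      div_self hα.ne', Real.rpow_one]
  refine ⟨p ^ n, negCount_of_pow_lt hα hn hn2, ?_, ?_⟩
  · push_cast
    rw [← hroot]
    exact Real.rpow_lt_rpow (by positivity) hn (by positivity)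
  · push_cast
    rw [← pow_succ', ← hroot]
    exact Real.rpow_le_rpow (by linarith) hn2 (by positivity)

end Count

end PadicSchrodinger

theorem mainTheorem5 (p : ℕ) [Fact p.Prime] (α σ : ℝ) (hα : 0 < α) (hσ : 0 < σ) :
    (σ ≤ ((p : ℝ) - (p : ℝ) ^ α) / ((p : ℝ) - 1) →
      PadicSchrodinger.negCount (PadicSchrodinger.schrodinger p α σ) = 0) ∧
    (((p : ℝ) - (p : ℝ) ^ α) / ((p : ℝ) - 1) < σ → σ ≤ (p : ℝ) ^ α →
      PadicSchrodinger.negCount (PadicSchrodinger.schrodinger p α σ) = 1) ∧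
    ((p : ℝ) ^ α < σ →
      ∃ N : ℕ, PadicSchrodinger.negCount (PadicSchrodinger.schrodinger p α σ) = (N : Cardinal) ∧
        1 / (2 * (p : ℝ)) *
            ∫ x, PadicSchrodinger.potential p σ x ^ (1 / α) ∂PadicSchrodinger.haar p ≤ (N : ℝ) ∧
        (N : ℝ) ≤ 3 / 2 *
            ∫ x, PadicSchrodinger.potential p σ x ^ (1 / α) ∂PadicSchrodinger.haar p) := by
  refine ⟨PadicSchrodinger.negCount_of_le_critical hα hσ,
    PadicSchrodinger.negCount_of_critical_lt_of_le hα hσ, fun h => ?_⟩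
  -- With I the integral, the count satisfies N < I ≤ pN, so the constants 1/(2p) and 3/2 hold with
  -- room to spare.
  obtain ⟨N, hN, h1, h2⟩ := PadicSchrodinger.exists_negCount_eq hα h
  have hp : (0 : ℝ) < p := by linarith [PadicSchrodinger.one_lt_prime_real p]
  have hN0 : (0 : ℝ) ≤ N := N.cast_nonneg
  refine ⟨N, hN, ?_, ?_⟩ <;> rw [PadicSchrodinger.integral_potential_rpow hα]
  · rw [one_div, inv_mul_le_iff₀ (by positivity)]
    linarith [mul_nonneg hp.le hN0]
  · linarith
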